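/- Let $A$ be a separable C*-algebra, let $H$ be a countable discrete group and let $\alpha\colon H\to\mathrm{Aut}(A)$ be an action. Notation. Let $A_\infty=\ell^\infty(\mathbb N,A)/\{(a_n)_n : \|a_n\|\to 0\}$, which contains $A$ as (classes of) constant sequences, and let $\alpha_\infty$ be the action of $H$ on $A_\infty$ given by componentwise application of $\alpha$. Let $D_{\infty,A}=\overline{A\cdot A_\infty\cdot A}\subseteq A_\infty$ (closed linear span), which contains $A$ and is $\alpha_\infty$-invariant, and let $\tilde\alpha_\infty$ be the induced action of $H$ on the multiplier algebra $\mathcal M(D_{\infty,A})$. Let $A\rtimes_\alpha H$ be the full crossed product, with canonical unitary representation $\lambda^\alpha\colon H\to\mathcal U(\mathcal M(A\rtimes_\alpha H))$ and canonical inclusion $\iota_A\colon A\to A\rtimes_\alpha H$, and let $\mathrm{ad}(\lambda^\alpha)$ be the action of $H$ on $A\rtimes_\alpha H$ given by $h\mapsto \lambda^\alpha_h(\,\cdot\,)(\lambda^\alpha_h)^*$. The following are equivalent: (i) $\alpha$ is approximately representable, i.e. there are contractions $x_{n,h}\in A$ ($n\in\mathbb N$, $h\in H$) such that 1. for every $h\in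 H$, the sequences $(x_{n,h}x_{n,h}^*)_n$ and $(x_{n,h}^*x_{n,h})_n$ are (not necessarily increasing) approximate units for $A$; 2. for all $g,h\in H$ and $a\in A$, $\lim_{n\to\infty}\big(\|a(x_{n,g}x_{n,h}-x_{n,gh})\|+\|(x_{n,g}x_{n,h}-x_{n,gh})a\|\big)=0$; 3. for all $a\in A$ and $h\in H$, $\lim_{n\to\infty}\|\alpha_h(a)-x_{n,h}\,a\,x_{n,h}^*\|=0$; 4. for all $g,h\in H$ and $a\in A$, $\lim_{n\to\infty}\big(\|a(x_{n,ghg^{-1}}-\alpha_g(x_{n,h}))\|+\|(x_{n,ghg^{-1}}-\alpha_g(x_{n,h}))a\|\big)=0$. (ii) There is a unitary representation (group homomorphism) $w\colon H\to\mathcal U(\mathcal M(D_{\infty,A}))$ such that, for all $a\in A$ and $g,h\in H$, $$\alpha_h(a)=w_h\,a\,w_h^*\quad\text{and}\quad \tilde\alpha_{\infty,h}(w_g)=w_{hgh^{-1}}.$$ (iii) The inclusion $\iota_A\colon(A,\alpha)\to(A\rtimes_\alpha H,\mathrm{ad}(\lambda^\alpha))$ is equivariantly sequentially split, i.e. there is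 a $*$-homomorphism $\psi\colon A\rtimes_\alpha H\to A_\infty$ that is $\mathrm{ad}(\lambda^\alpha)$-to-$\alpha_\infty$-equivariant and satisfies $\psi(\iota_A(a))=a$ for all $a\in A$. -/

import Mathlib

noncomputable section

namespace CStarDyn

open Filter Topology
open scoped ENNReal MultiplierAlgebra

universe u v

/-! ### The sequence algebra `A_∞ = ℓ^∞(ℕ, A) / c₀(ℕ, A)` -/

section SequenceAlgebra

variable (A : Type u) [NonUnitalCStarAlgebra A]

/-- The C⋆-algebra `ℓ^∞(ℕ, A)` of bounded sequences in `A`. -/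
abbrev BddSeq : Type u := lp (fun _ : ℕ => A) ∞

/-- The ideal `c₀(ℕ, A)` of sequences converging to zero in norm. -/
def nullSeq : Submodule ℂ (BddSeq A) where
  carrier := {x | Tendsto (fun n => x n) atTop (𝓝 0)}
  add_mem' {x y} hx hy := by
    have := Tendsto.add (f := fun n => x n) (g := fun n => y n) hx hy
    simpa using this
  zero_mem' := by
    simp
  smul_mem' c x hx := by
    have := Tendsto.const_smul (f := fun n => x n) hx c
    simpa using this

variable {A}

lemma mem_nullSeq {x : BddSeq A} : x ∈ nullSeq A ↔ Tendsto (fun n => x n) atTop (𝓝 0) := Iff.rfl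

lemma mul_left_mem_nullSeq (y : BddSeq A) {x : BddSeq A} (hx : x ∈ nullSeq A) :
    y * x ∈ nullSeq A := by
  rw [mem_nullSeq] at hx ⊢
  have h1 : Tendsto (fun n => ‖y‖ * ‖x n‖) atTop (𝓝 0) := by
    simpa using hx.norm.const_mul ‖y‖
  refine squeeze_zero_norm (fun n => ?_) h1
  rw [lp.infty_coeFn_mul, Pi.mul_apply]
  exact (norm_mul_le _ _).trans (by gcongr; exact lp.norm_apply_le_norm (by simp) y n)

lemma mul_right_mem_nullSeq (y : BddSeq A) {x : BddSeq A} (hx : x ∈ nullSeq A) :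
    x * y ∈ nullSeq A := by
  rw [mem_nullSeq] at hx ⊢
  have h1 : Tendsto (fun n => ‖x n‖ * ‖y‖) atTop (𝓝 0) := by
    simpa using hx.norm.mul_const ‖y‖
  refine squeeze_zero_norm (fun n => ?_) h1
  rw [lp.infty_coeFn_mul, Pi.mul_apply]
  exact (norm_mul_le _ _).trans (by gcongr; exact lp.norm_apply_le_norm (by simp) y n)

lemma star_mem_nullSeq {x : BddSeq A} (hx : x ∈ nullSeq A) : star x ∈ nullSeq A := by
  rw [mem_nullSeq] at hx ⊢
  simpa using hx.star

instance isClosed_nullSeq : IsClosed (nullSeq A : Set (BddSeq A)) := by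
  refine isClosed_of_closure_subset fun x hx => ?_
  rw [SetLike.mem_coe, mem_nullSeq, Metric.tendsto_atTop]
  intro ε hε
  obtain ⟨y, hy, hxy⟩ := Metric.mem_closure_iff.1 hx (ε / 2) (by positivity)
  obtain ⟨N, hN⟩ := Metric.tendsto_atTop.1 (mem_nullSeq.1 hy) (ε / 2) (by positivity)
  refine ⟨N, fun n hn => ?_⟩
  have h1 := hN n hn
  have h2 : ‖(x - y) n‖ ≤ ‖x - y‖ := lp.norm_apply_le_norm (by simp) (x - y) n
  rw [dist_eq_norm] at hxy
  rw [dist_zero_right] at h1 ⊢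
  have h3 : x n = (x - y) n + y n := by simp
  rw [h3]
  refine (norm_add_le _ _).trans_lt ?_
  linarith

variable (A) in
/-- The sequence algebra `A_∞ = ℓ^∞(ℕ, A) / c₀(ℕ, A)`, with the quotient norm. -/
def SeqAlg : Type u := BddSeq A ⧸ nullSeq A

namespace SeqAlg

instance : NormedAddCommGroup (SeqAlg A) :=
  inferInstanceAs (NormedAddCommGroup (BddSeq A ⧸ nullSeq A))

instance : NormedSpace ℂ (SeqAlg A) :=
  inferInstanceAs (NormedSpace ℂ (BddSeq A ⧸ nullSeq A))

instance : CompleteSpace (SeqAlg A) :=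
  inferInstanceAs (CompleteSpace (BddSeq A ⧸ nullSeq A))

/-- The class of a bounded sequence in the sequence algebra. -/
def mk (x : BddSeq A) : SeqAlg A := Submodule.Quotient.mk x

lemma mk_add (x y : BddSeq A) : mk (x + y) = mk x + mk y := rfl

lemma mk_zero : mk (0 : BddSeq A) = 0 := rfl

lemma mk_smul (c : ℂ) (x : BddSeq A) : mk (c • x) = c • mk x := rfl

lemma mk_surjective : Function.Surjective (mk : BddSeq A → SeqAlg A) :=
  Submodule.mkQ_surjective _

lemma mk_eq_mk {x y : BddSeq A} : mk x = mk y ↔ x - y ∈ nullSeq A :=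
  Submodule.Quotient.eq (nullSeq A)

lemma norm_mk_le (x : BddSeq A) : ‖mk x‖ ≤ ‖x‖ :=
  Submodule.Quotient.norm_mk_le (nullSeq A) x

lemma exists_mk_lt (x : SeqAlg A) {ε : ℝ} (hε : 0 < ε) : ∃ y, mk y = x ∧ ‖y‖ < ‖x‖ + ε :=
  Submodule.Quotient.norm_mk_lt (S := nullSeq A) x hε

instance : Mul (SeqAlg A) where
  mul := Quotient.map₂ (· * ·) (by
    intro a b hab c d hcd
    have h1 : a - b ∈ nullSeq A := (Submodule.quotientRel_def _).1 hab
    have h2 : c - d ∈ nullSeq A := (Submodule.quotientRel_def _).1 hcd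
    refine (Submodule.quotientRel_def _).2 ?_
    have : a * c - b * d = (a - b) * c + b * (c - d) := by
      rw [sub_mul, mul_sub]; abel
    rw [this]
    exact add_mem (mul_right_mem_nullSeq c h1) (mul_left_mem_nullSeq b h2))

instance : Star (SeqAlg A) where
  star := Quotient.map star (by
    intro a b hab
    have h1 : a - b ∈ nullSeq A := (Submodule.quotientRel_def _).1 hab
    refine (Submodule.quotientRel_def _).2 ?_
    rw [← star_sub]
    exact star_mem_nullSeq h1)

lemma mk_mul (x y : BddSeq A) : mk (x * y) = mk x * mk y := rfl

lemma mk_star (x : BddSeq A) : mk (star x) = star (mk x) := rfl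

instance : NonUnitalNormedRing (SeqAlg A) where
  __ := (inferInstance : NormedAddCommGroup (SeqAlg A))
  __ := (inferInstance : Mul (SeqAlg A))
  left_distrib a b c := by
    obtain ⟨a, rfl⟩ := mk_surjective a
    obtain ⟨b, rfl⟩ := mk_surjective b
    obtain ⟨c, rfl⟩ := mk_surjective c
    simp only [← mk_add, ← mk_mul, mul_add]
  right_distrib a b c := by
    obtain ⟨a, rfl⟩ := mk_surjective a
    obtain ⟨b, rfl⟩ := mk_surjective b
    obtain ⟨c, rfl⟩ := mk_surjective c
    simp only [← mk_add, ← mk_mul, add_mul]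
  zero_mul a := by
    obtain ⟨a, rfl⟩ := mk_surjective a
    rw [← mk_zero, ← mk_mul, zero_mul]
  mul_zero a := by
    obtain ⟨a, rfl⟩ := mk_surjective a
    rw [← mk_zero, ← mk_mul, mul_zero]
  mul_assoc a b c := by
    obtain ⟨a, rfl⟩ := mk_surjective a
    obtain ⟨b, rfl⟩ := mk_surjective b
    obtain ⟨c, rfl⟩ := mk_surjective c
    simp only [← mk_mul, mul_assoc]
  norm_mul_le a b := by
    have key : ∀ ε : ℝ, 0 < ε → ‖a * b‖ ≤ (‖a‖ + ε) * (‖b‖ + ε) := by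
      intro ε hε
      obtain ⟨x, rfl, hx⟩ := exists_mk_lt a hε
      obtain ⟨y, rfl, hy⟩ := exists_mk_lt b hε
      rw [← mk_mul]
      exact (norm_mk_le _).trans ((norm_mul_le _ _).trans (by gcongr))
    have hlim : Tendsto (fun ε : ℝ => (‖a‖ + ε) * (‖b‖ + ε)) (𝓝[>] 0) (𝓝 (‖a‖ * ‖b‖)) := by
      have : Tendsto (fun ε : ℝ => (‖a‖ + ε) * (‖b‖ + ε)) (𝓝 0)
          (𝓝 ((‖a‖ + 0) * (‖b‖ + 0))) := Continuous.tendsto (by fun_prop) 0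
      simpa using this.mono_left nhdsWithin_le_nhds
    exact ge_of_tendsto hlim (eventually_nhdsWithin_of_forall fun ε hε => key ε hε)

instance : StarRing (SeqAlg A) where
  star_involutive a := by
    obtain ⟨a, rfl⟩ := mk_surjective a
    simp only [← mk_star, star_star]
  star_mul a b := by
    obtain ⟨a, rfl⟩ := mk_surjective a
    obtain ⟨b, rfl⟩ := mk_surjective b
    simp only [← mk_star, ← mk_mul, star_mul]
  star_add a b := by
    obtain ⟨a, rfl⟩ := mk_surjective a
    obtain ⟨b, rfl⟩ := mk_surjective b
    simp only [← mk_star, ← mk_add, star_add]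

/-- Cutting off finitely many terms of a sequence does not change its class. -/
lemma norm_mk_le_of_eventually (x : BddSeq A) {r : ℝ} (hr : 0 ≤ r)
    (h : ∀ᶠ n in atTop, ‖x n‖ ≤ r) : ‖mk x‖ ≤ r := by
  obtain ⟨N, hN⟩ := eventually_atTop.1 h
  have hbd : ∀ n, ‖(if N ≤ n then x n else 0 : A)‖ ≤ r := fun n => by
    split_ifs with hn
    · exact hN n hn
    · simpa using hr
  let y : BddSeq A := ⟨fun n => if N ≤ n then x n else 0,
    memℓp_infty ⟨r, by rintro _ ⟨n, rfl⟩; exact hbd n⟩⟩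
  have hy : ‖y‖ ≤ r := lp.norm_le_of_forall_le hr hbd
  have hxy : mk x = mk y := by
    rw [mk_eq_mk, mem_nullSeq]
    refine tendsto_const_nhds.congr' ?_
    filter_upwards [eventually_ge_atTop N] with n hn
    change (0 : A) = x n - (if N ≤ n then x n else 0)
    simp [hn]
  rw [hxy]
  exact (norm_mk_le y).trans hy

lemma eventually_norm_le (x : BddSeq A) {r : ℝ} (hr : ‖mk x‖ < r) :
    ∀ᶠ n in atTop, ‖x n‖ ≤ r := by
  obtain ⟨y, hyx, hy⟩ := exists_mk_lt (mk x) (show 0 < (r - ‖mk x‖) / 2 by linarith)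
  have hd : Tendsto (fun n => (x - y) n) atTop (𝓝 0) := mem_nullSeq.1 (mk_eq_mk.1 hyx.symm)
  have hev := (tendsto_zero_iff_norm_tendsto_zero.1 hd).eventually
    (gt_mem_nhds (show 0 < (r - ‖mk x‖) / 2 by linarith))
  filter_upwards [hev] with n hn
  have h3 : x n = (x - y) n + y n := by simp
  have h4 : ‖y n‖ ≤ ‖y‖ := lp.norm_apply_le_norm (by simp) y n
  rw [h3]
  refine (norm_add_le _ _).trans ?_
  linarith

instance : CStarRing (SeqAlg A) where
  norm_mul_self_le a := by
    obtain ⟨x, rfl⟩ := mk_surjective a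
    rw [← mk_star, ← mk_mul]
    refine le_of_forall_gt fun r hr => ?_
    obtain ⟨s, hs1, hs2⟩ := exists_between hr
    have hs0 : 0 ≤ s := (norm_nonneg _).trans hs1.le
    have h1 : ‖mk x‖ ≤ Real.sqrt s := by
      refine norm_mk_le_of_eventually x (Real.sqrt_nonneg s) ?_
      filter_upwards [eventually_norm_le _ hs1] with n hn
      have h2 : ‖star (x n) * x n‖ ≤ s := by simpa [lp.infty_coeFn_mul] using hn
      rw [CStarRing.norm_star_mul_self] at h2
      exact Real.le_sqrt_of_sq_le (by rw [sq]; exact h2)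
    calc ‖mk x‖ * ‖mk x‖ ≤ Real.sqrt s * Real.sqrt s := by gcongr
      _ = s := Real.mul_self_sqrt hs0
      _ < r := hs2

instance : NonUnitalCStarAlgebra (SeqAlg A) where
  smul_assoc c a b := by
    obtain ⟨a, rfl⟩ := mk_surjective a
    obtain ⟨b, rfl⟩ := mk_surjective b
    simp only [smul_eq_mul, ← mk_smul, ← mk_mul, smul_mul_assoc]
  smul_comm c a b := by
    obtain ⟨a, rfl⟩ := mk_surjective a
    obtain ⟨b, rfl⟩ := mk_surjective b
    simp only [smul_eq_mul, ← mk_smul, ← mk_mul, mul_smul_comm]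
  star_smul c a := by
    obtain ⟨a, rfl⟩ := mk_surjective a
    simp only [← mk_star, ← mk_smul, star_smul]

/-- The canonical embedding of `A` into `A_∞` as constant sequences. -/
def const : A →⋆ₙₐ[ℂ] SeqAlg A where
  toFun a := mk ⟨fun _ => a, memℓp_infty ⟨‖a‖, by rintro _ ⟨n, rfl⟩; rfl⟩⟩
  map_smul' _ _ := rfl
  map_zero' := rfl
  map_add' _ _ := rfl
  map_mul' _ _ := rfl
  map_star' _ := rfl

/-- Componentwise application of an automorphism to bounded sequences. -/
def mapBdd (σ : A ≃⋆ₐ[ℂ] A) (x : BddSeq A) : BddSeq A :=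
  ⟨fun n => σ (x n), memℓp_infty ⟨‖x‖, by
    rintro _ ⟨n, rfl⟩
    exact (NonUnitalStarAlgHom.norm_apply_le σ (x n)).trans (lp.norm_apply_le_norm (by simp) x n)⟩⟩

lemma mapBdd_sub_mem (σ : A ≃⋆ₐ[ℂ] A) {x y : BddSeq A} (h : x - y ∈ nullSeq A) :
    mapBdd σ x - mapBdd σ y ∈ nullSeq A := by
  rw [mem_nullSeq] at h ⊢
  have h1 : Tendsto (fun n => ‖(x - y) n‖) atTop (𝓝 0) := by simpa using h.norm
  refine squeeze_zero_norm (fun n => ?_) h1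
  have h2 : (mapBdd σ x - mapBdd σ y) n = σ ((x - y) n) := by
    rw [lp.coeFn_sub, lp.coeFn_sub, Pi.sub_apply, Pi.sub_apply, map_sub]
    rfl
  rw [h2]
  exact NonUnitalStarAlgHom.norm_apply_le σ _

/-- The map induced on `A_∞` by componentwise application of an automorphism. -/
def map (σ : A ≃⋆ₐ[ℂ] A) : SeqAlg A → SeqAlg A :=
  Quotient.map (mapBdd σ) (fun _ _ hab =>
    (Submodule.quotientRel_def _).2 (mapBdd_sub_mem σ ((Submodule.quotientRel_def _).1 hab)))

lemma map_mk (σ : A ≃⋆ₐ[ℂ] A) (x : BddSeq A) : map σ (mk x) = mk (mapBdd σ x) := rfl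

/-- The action of the automorphism group of `A` on `A_∞` by componentwise application. -/
def aut : (A ≃⋆ₐ[ℂ] A) →* (SeqAlg A ≃⋆ₐ[ℂ] SeqAlg A) where
  toFun σ :=
    { toFun := map σ
      invFun := map σ.symm
      left_inv a := by
        obtain ⟨a, rfl⟩ := mk_surjective a
        simp only [map_mk]
        congr 1
        ext n
        simp [mapBdd]
      right_inv a := by
        obtain ⟨a, rfl⟩ := mk_surjective a
        simp only [map_mk]
        congr 1
        ext n
        simp [mapBdd]
      map_mul' a b := by
        obtain ⟨a, rfl⟩ := mk_surjective a
        obtain ⟨b, rfl⟩ := mk_surjective b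
        simp only [map_mk, ← mk_mul]
        congr 1
        ext n
        simp [mapBdd, lp.infty_coeFn_mul]
      map_add' a b := by
        obtain ⟨a, rfl⟩ := mk_surjective a
        obtain ⟨b, rfl⟩ := mk_surjective b
        simp only [map_mk, ← mk_add]
        congr 1
        ext n
        exact map_add σ (a n) (b n)
      map_star' a := by
        obtain ⟨a, rfl⟩ := mk_surjective a
        simp only [map_mk, ← mk_star]
        congr 1
        ext n
        simp [mapBdd, map_star]
      map_smul' c a := by
        obtain ⟨a, rfl⟩ := mk_surjective a
        simp only [map_mk, ← mk_smul]
        congr 1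
        ext n
        simp [mapBdd] }
  map_one' := by
    ext a
    obtain ⟨a, rfl⟩ := mk_surjective a
    rfl
  map_mul' σ τ := by
    ext a
    obtain ⟨a, rfl⟩ := mk_surjective a
    rfl

lemma aut_const (σ : A ≃⋆ₐ[ℂ] A) (a : A) : aut σ (const a) = const (σ a) := rfl

end SeqAlg

end SequenceAlgebra

/-! ### The algebra `D_{∞,A} = closure of A · A_∞ · A` -/

section Hereditary

variable (A : Type u) [NonUnitalCStarAlgebra A]

/-- The products `a x b` with `a, b ∈ A` and `x ∈ A_∞`. -/
def sandwich : Set (SeqAlg A) :=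
  {z | ∃ (a : A) (x : SeqAlg A) (b : A), z = SeqAlg.const a * x * SeqAlg.const b}

/-- The closed linear span of `A · A_∞ · A` in `A_∞`. -/
def sandwichSpan : Submodule ℂ (SeqAlg A) := (Submodule.span ℂ (sandwich A)).topologicalClosure

variable {A}

lemma sandwichSpan_induction {p : SeqAlg A → Prop} (hp : IsClosed {x | p x})
    (h0 : p 0) (hadd : ∀ x y, p x → p y → p (x + y)) (hsmul : ∀ (c : ℂ) x, p x → p (c • x))
    (hs : ∀ x ∈ sandwich A, p x) {x : SeqAlg A} (hx : x ∈ sandwichSpan A) : p x := by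
  have h1 : (Submodule.span ℂ (sandwich A) : Set (SeqAlg A)) ⊆ {x | p x} := fun y hy =>
    Submodule.span_induction (p := fun z _ => p z) hs h0 (fun x y _ _ => hadd x y)
      (fun c x _ => hsmul c x) hy
  exact closure_minimal h1 hp hx

lemma isClosed_sandwichSpan : IsClosed (sandwichSpan A : Set (SeqAlg A)) :=
  Submodule.isClosed_topologicalClosure _

lemma sandwich_subset {x : SeqAlg A} (hx : x ∈ sandwich A) : x ∈ sandwichSpan A :=
  Submodule.le_topologicalClosure _ (Submodule.subset_span hx)

variable (A) in
/-- The C⋆-subalgebra `D_{∞,A}` of `A_∞`, the closed linear span of `A · A_∞ · A`. -/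
def DAlg : NonUnitalStarSubalgebra ℂ (SeqAlg A) where
  __ := sandwichSpan A
  mul_mem' {x y} hx hy := by
    change x ∈ sandwichSpan A at hx
    change y ∈ sandwichSpan A at hy
    change x * y ∈ sandwichSpan A
    refine sandwichSpan_induction (p := fun x => x * y ∈ sandwichSpan A)
      (isClosed_sandwichSpan.preimage (continuous_mul_const y)) (by simp)
      (fun _ _ h1 h2 => by rw [add_mul]; exact add_mem h1 h2)
      (fun c _ h => by rw [smul_mul_assoc]; exact Submodule.smul_mem _ c h) ?_ hx
    rintro _ ⟨a, x, b, rfl⟩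
    refine sandwichSpan_induction
      (p := fun y => SeqAlg.const a * x * SeqAlg.const b * y ∈ sandwichSpan A)
      (isClosed_sandwichSpan.preimage (continuous_const_mul _)) (by simp)
      (fun _ _ h1 h2 => by rw [mul_add]; exact add_mem h1 h2)
      (fun c _ h => by rw [mul_smul_comm]; exact Submodule.smul_mem _ c h) ?_ hy
    rintro _ ⟨a', x', b', rfl⟩
    exact sandwich_subset ⟨a, x * SeqAlg.const b * SeqAlg.const a' * x', b', by
      simp only [mul_assoc]⟩
  star_mem' {x} hx := by
    change x ∈ sandwichSpan A at hx
    change star x ∈ sandwichSpan A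
    refine sandwichSpan_induction (p := fun x => star x ∈ sandwichSpan A)
      (isClosed_sandwichSpan.preimage continuous_star) (by simp)
      (fun _ _ h1 h2 => by rw [star_add]; exact add_mem h1 h2)
      (fun c _ h => by rw [star_smul]; exact Submodule.smul_mem _ _ h) ?_ hx
    rintro _ ⟨a, x, b, rfl⟩
    exact sandwich_subset ⟨star b, star x, star a, by simp [map_star, mul_assoc]⟩

lemma mem_DAlg {x : SeqAlg A} : x ∈ DAlg A ↔ x ∈ sandwichSpan A := Iff.rfl

instance isClosed_DAlg : IsClosed (DAlg A : Set (SeqAlg A)) := isClosed_sandwichSpan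

lemma const_mem_DAlg (a : A) : SeqAlg.const a ∈ DAlg A := by
  let := CStarAlgebra.spectralOrder A
  let := CStarAlgebra.spectralOrderedRing A
  have hl := CStarAlgebra.increasingApproximateUnit A
  have := hl.neBot
  have hc : Continuous (SeqAlg.const (A := A)) :=
    AddMonoidHomClass.continuous_of_bound _ 1 fun a => by
      simpa using NonUnitalStarAlgHom.norm_apply_le (SeqAlg.const (A := A)) a
  have key : ∀ a b : A, SeqAlg.const (a * b) ∈ sandwichSpan A := fun a b => by
    have h1 : Tendsto (fun e => SeqAlg.const (a * (e * b))) (CStarAlgebra.approximateUnit A)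
        (𝓝 (SeqAlg.const (a * b))) :=
      (hc.tendsto _).comp ((hl.tendsto_mul_right b).const_mul a)
    refine isClosed_sandwichSpan.mem_of_tendsto h1 (Eventually.of_forall fun e => ?_)
    exact sandwich_subset ⟨a, SeqAlg.const e, b, by simp only [map_mul, mul_assoc]⟩
  exact isClosed_sandwichSpan.mem_of_tendsto ((hc.tendsto _).comp (hl.tendsto_mul_left a))
    (Eventually.of_forall fun e => key a e)

/-- The canonical embedding of `A` into `D_{∞,A}`. -/
def DAlg.const : A →⋆ₙₐ[ℂ] DAlg A :=
  NonUnitalStarAlgHom.codRestrict SeqAlg.const (DAlg A) const_mem_DAlg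

lemma DAlg.aut_mem (σ : A ≃⋆ₐ[ℂ] A) {x : SeqAlg A} (hx : x ∈ DAlg A) :
    SeqAlg.aut σ x ∈ DAlg A := by
  refine sandwichSpan_induction (p := fun x => SeqAlg.aut σ x ∈ sandwichSpan A)
    (isClosed_sandwichSpan.preimage (StarAlgEquiv.isometry (SeqAlg.aut σ)).continuous) (by simp)
    (fun _ _ h1 h2 => by rw [map_add]; exact add_mem h1 h2)
    (fun c _ h => by rw [map_smul]; exact Submodule.smul_mem _ c h) ?_ (mem_DAlg.1 hx)
  rintro _ ⟨a, x, b, rfl⟩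
  exact sandwich_subset ⟨σ a, SeqAlg.aut σ x, σ b, by
    simp only [map_mul, SeqAlg.aut_const]⟩

/-- The restriction to `D_{∞,A}` of the action of the automorphism group of `A` on `A_∞`. -/
def DAlg.aut : (A ≃⋆ₐ[ℂ] A) →* (DAlg A ≃⋆ₐ[ℂ] DAlg A) where
  toFun σ :=
    { toFun x := ⟨SeqAlg.aut σ x, DAlg.aut_mem σ x.2⟩
      invFun x := ⟨SeqAlg.aut σ⁻¹ x, DAlg.aut_mem σ⁻¹ x.2⟩
      left_inv x := by
        ext
        change (SeqAlg.aut σ⁻¹ * SeqAlg.aut σ) (x : SeqAlg A) = x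
        rw [← map_mul, inv_mul_cancel, map_one, StarAlgEquiv.one_apply]
      right_inv x := by
        ext
        change (SeqAlg.aut σ * SeqAlg.aut σ⁻¹) (x : SeqAlg A) = x
        rw [← map_mul, mul_inv_cancel, map_one, StarAlgEquiv.one_apply]
      map_mul' x y := by ext; exact map_mul (SeqAlg.aut σ) (x : SeqAlg A) y
      map_add' x y := by ext; exact map_add (SeqAlg.aut σ) (x : SeqAlg A) y
      map_star' x := by ext; exact map_star (SeqAlg.aut σ) (x : SeqAlg A)
      map_smul' c x := by ext; exact map_smul (SeqAlg.aut σ) c (x : SeqAlg A) }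
  map_one' := by
    ext x
    change SeqAlg.aut 1 (x : SeqAlg A) = x
    rw [map_one, StarAlgEquiv.one_apply]
  map_mul' σ τ := by
    ext x
    change SeqAlg.aut (σ * τ) (x : SeqAlg A) = (SeqAlg.aut σ * SeqAlg.aut τ) (x : SeqAlg A)
    rw [map_mul]

end Hereditary

/-! ### Multiplier algebras -/

section Multiplier

variable {B : Type u} [NonUnitalCStarAlgebra B]

/-- An automorphism as a continuous linear map. -/
def autCLM (σ : B ≃⋆ₐ[ℂ] B) : B →L[ℂ] B where
  toFun := σ
  map_add' := map_add σ
  map_smul' := map_smul σ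
  cont := (StarAlgEquiv.isometry σ).continuous

@[simp] lemma autCLM_apply (σ : B ≃⋆ₐ[ℂ] B) (x : B) : autCLM σ x = σ x := rfl

/-- The image of a multiplier `m = (L, R)` under (the extension to `M(B)` of) an automorphism
`σ` of `B`, given by `(σ L σ⁻¹, σ R σ⁻¹)`. -/
def mapMultiplier (σ : B ≃⋆ₐ[ℂ] B) (m : 𝓜(ℂ, B)) : 𝓜(ℂ, B) where
  fst := (autCLM σ).comp (m.fst.comp (autCLM σ⁻¹))
  snd := (autCLM σ).comp (m.snd.comp (autCLM σ⁻¹))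
  central x y := by
    have hx : σ (σ⁻¹ x) = x := σ.apply_symm_apply x
    have hy : σ (σ⁻¹ y) = y := σ.apply_symm_apply y
    change σ (m.snd (σ⁻¹ x)) * y = x * σ (m.fst (σ⁻¹ y))
    conv_lhs => rw [← hy, ← map_mul, m.central, map_mul, hx]

/-- The extension of automorphisms of `B` to automorphisms of the multiplier algebra. -/
def multiplierAut : (B ≃⋆ₐ[ℂ] B) →* (𝓜(ℂ, B) ≃⋆ₐ[ℂ] 𝓜(ℂ, B)) where
  toFun σ :=
    { toFun := mapMultiplier σ
      invFun := mapMultiplier σ⁻¹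
      left_inv m := by
        ext x <;> simp [mapMultiplier, StarAlgEquiv.aut_inv]
      right_inv m := by
        ext x <;> simp [mapMultiplier, StarAlgEquiv.aut_inv]
      map_mul' m n := by
        ext x <;> simp [mapMultiplier, StarAlgEquiv.aut_inv]
      map_add' m n := by
        ext x <;> simp [mapMultiplier]
      map_star' m := by
        ext x <;> simp [mapMultiplier, map_star]
      map_smul' c m := by
        ext x <;> simp [mapMultiplier] }
  map_one' := by ext m x <;> rfl
  map_mul' σ τ := by
    ext m x <;> simp [mapMultiplier]

/-- Left and right nondegeneracy of a C⋆-algebra. -/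
lemma eq_of_forall_mul_left {x y : B} (h : ∀ z, z * x = z * y) : x = y := by
  have h1 : star (x - y) * (x - y) = 0 := by rw [mul_sub, h, sub_self]
  exact sub_eq_zero.1 (CStarRing.star_mul_self_eq_zero_iff _ |>.1 h1)

lemma multiplier_fst_mul (m : 𝓜(ℂ, B)) (x y : B) : m.fst (x * y) = m.fst x * y := by
  refine eq_of_forall_mul_left fun z => ?_
  rw [← m.central, ← mul_assoc, m.central, mul_assoc]

lemma multiplier_mul_coe (m : 𝓜(ℂ, B)) (x : B) :
    m * (x : 𝓜(ℂ, B)) = (m.fst x : 𝓜(ℂ, B)) := by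
  ext y
  · exact multiplier_fst_mul m x y
  · exact m.central y x

lemma multiplier_coe_mul (m : 𝓜(ℂ, B)) (x : B) :
    (x : 𝓜(ℂ, B)) * m = (m.snd x : 𝓜(ℂ, B)) := by
  have h := congrArg star (multiplier_mul_coe (star m) (star x))
  have h1 : ∀ z : B, ((star z : B) : 𝓜(ℂ, B)) = star (z : 𝓜(ℂ, B)) :=
    fun z => map_star DoubleCentralizer.coeHom z
  rw [star_mul, star_star, h1, star_star, ← h1] at h
  rw [h, DoubleCentralizer.star_fst, star_star, star_star]

lemma multiplier_coe_injective {x y : B} (h : (x : 𝓜(ℂ, B)) = y) : x = y :=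
  eq_of_forall_mul_left fun z => by
    have := congrArg (fun m : 𝓜(ℂ, B) => m.snd z) h
    exact this

/-- Conjugation of `x ∈ B` by a unitary multiplier `u`: the element `u x u⋆` of `B`. -/
def conjMul (u : unitary 𝓜(ℂ, B)) (x : B) : B :=
  (u : 𝓜(ℂ, B)).fst ((star (u : 𝓜(ℂ, B))).snd x)

lemma coe_conjMul (u : unitary 𝓜(ℂ, B)) (x : B) :
    ((conjMul u x : B) : 𝓜(ℂ, B)) = (u : 𝓜(ℂ, B)) * (x : 𝓜(ℂ, B)) * star (u : 𝓜(ℂ, B)) := by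
  rw [conjMul, ← multiplier_mul_coe, ← multiplier_coe_mul, mul_assoc]

lemma conjMul_conjMul (u v : unitary 𝓜(ℂ, B)) (x : B) :
    conjMul u (conjMul v x) = conjMul (u * v) x := by
  apply multiplier_coe_injective
  simp only [coe_conjMul, Submonoid.coe_mul, star_mul, mul_assoc]

lemma conjMul_one (x : B) : conjMul (1 : unitary 𝓜(ℂ, B)) x = x := by
  apply multiplier_coe_injective
  simp [coe_conjMul]

/-- The action `ad` of the unitary group of `M(B)` on `B`, by `ad(u)(x) = u x u⋆`. -/
def ad : unitary 𝓜(ℂ, B) →* (B ≃⋆ₐ[ℂ] B) where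
  toFun u :=
    { toFun := conjMul u
      invFun := conjMul u⁻¹
      left_inv x := by rw [conjMul_conjMul, inv_mul_cancel, conjMul_one]
      right_inv x := by rw [conjMul_conjMul, mul_inv_cancel, conjMul_one]
      map_mul' x y := by
        apply multiplier_coe_injective
        have h1 : ∀ z w : B, ((z * w : B) : 𝓜(ℂ, B)) = (z : 𝓜(ℂ, B)) * (w : 𝓜(ℂ, B)) :=
          fun z w => map_mul DoubleCentralizer.coeHom z w
        have h2 : star (u : 𝓜(ℂ, B)) * (u : 𝓜(ℂ, B)) = 1 := Unitary.coe_star_mul_self u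
        rw [h1, coe_conjMul, coe_conjMul, coe_conjMul, h1]
        simp only [mul_assoc]
        rw [← mul_assoc (star (u : 𝓜(ℂ, B))) (u : 𝓜(ℂ, B)), h2, one_mul]
      map_add' x y := by simp [conjMul]
      map_star' x := by
        apply multiplier_coe_injective
        have h1 : ∀ z : B, ((star z : B) : 𝓜(ℂ, B)) = star (z : 𝓜(ℂ, B)) :=
          fun z => map_star DoubleCentralizer.coeHom z
        rw [coe_conjMul, h1, h1, coe_conjMul]
        simp only [star_mul, star_star, mul_assoc]
      map_smul' c x := by simp [conjMul] }
  map_one' := by ext x; exact conjMul_one x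
  map_mul' u v := by ext x; exact (conjMul_conjMul u v x).symm

end Multiplier

/-! ### The crossed product by a discrete group -/

section CrossedProduct

variable {A : Type u} [NonUnitalCStarAlgebra A] {H : Type v} [Group H]

/-- The ⋆-algebra `C_c(H, A)` of finitely supported functions `H → A` with the convolution product
and involution twisted by the action `α`. The function supported at `h` with value `a` is
thought of as `a δ_h`. -/
def TwistedAlg (_α : H →* (A ≃⋆ₐ[ℂ] A)) : Type (max u v) := H →₀ A

namespace TwistedAlg

variable {α : H →* (A ≃⋆ₐ[ℂ] A)}

instance : AddCommGroup (TwistedAlg α) := inferInstanceAs (AddCommGroup (H →₀ A))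

instance : Module ℂ (TwistedAlg α) := inferInstanceAs (Module ℂ (H →₀ A))

variable (α) in
/-- The element `a δ_h`. -/
def single (h : H) (a : A) : TwistedAlg α := Finsupp.single h a

/-- The product, determined by `(a δ_h) (b δ_k) = a α_h(b) δ_{hk}`. -/
instance : Mul (TwistedAlg α) where
  mul f g := Finsupp.sum f fun h a => Finsupp.sum g fun k b => single α (h * k) (a * α h b)

/-- The involution, determined by `(a δ_h)⋆ = α_{h⁻¹}(a⋆) δ_{h⁻¹}`. -/
instance : Star (TwistedAlg α) where
  star f := Finsupp.sum f fun h a => single α h⁻¹ (α h⁻¹ (star a))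

@[elab_as_elim]
lemma induction {p : TwistedAlg α → Prop} (f : TwistedAlg α) (h0 : p 0)
    (hadd : ∀ f g, p f → p g → p (f + g)) (hs : ∀ h a, p (single α h a)) : p f :=
  Finsupp.induction_linear f h0 hadd hs

lemma single_zero (h : H) : single α h 0 = 0 := Finsupp.single_zero h

lemma single_add (h : H) (a b : A) : single α h (a + b) = single α h a + single α h b :=
  Finsupp.single_add h a b

lemma smul_single (c : ℂ) (h : H) (a : A) : c • single α h a = single α h (c • a) :=
  Finsupp.smul_single c h a

lemma mul_def (f g : TwistedAlg α) : f * g =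
    Finsupp.sum f fun h a => Finsupp.sum g fun k b => single α (h * k) (a * α h b) := rfl

lemma star_def (f : TwistedAlg α) :
    star f = Finsupp.sum f fun h a => single α h⁻¹ (α h⁻¹ (star a)) := rfl

lemma single_mul_single (h k : H) (a b : A) :
    single α h a * single α k b = single α (h * k) (a * α h b) := by
  rw [mul_def]
  refine (Finsupp.sum_single_index ?_).trans ?_
  · exact Finset.sum_eq_zero fun _ _ => by simp [single_zero]
  · exact Finsupp.sum_single_index (by simp [single_zero])

lemma star_single (h : H) (a : A) :
    star (single α h a) = single α h⁻¹ (α h⁻¹ (star a)) :=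
  Finsupp.sum_single_index (by simp [single_zero])

instance : NonUnitalNonAssocRing (TwistedAlg α) where
  left_distrib f g₁ g₂ := by
    refine (Finset.sum_congr rfl fun h _ => ?_).trans Finset.sum_add_distrib
    exact Finsupp.sum_add_index' (by simp [single_zero])
      (fun k b₁ b₂ => by rw [map_add, mul_add, single_add])
  right_distrib f₁ f₂ g := by
    refine Finsupp.sum_add_index' (fun h => ?_) (fun h a₁ a₂ => ?_)
    · exact Finset.sum_eq_zero fun _ _ => by simp [single_zero]
    · refine (Finset.sum_congr rfl fun k _ => ?_).trans Finset.sum_add_distrib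
      exact (congrArg (single α _) (add_mul _ _ _)).trans (single_add _ _ _)
  zero_mul f := Finsupp.sum_zero_index
  mul_zero f := by
    rw [mul_def]
    exact Finset.sum_eq_zero fun h _ => Finsupp.sum_zero_index

instance : NonUnitalRing (TwistedAlg α) where
  mul_assoc f g k := by
    induction f using induction with
    | h0 => simp
    | hadd f₁ f₂ h₁ h₂ => simp only [add_mul, h₁, h₂]
    | hs h₁ a =>
      induction g using induction with
      | h0 => simp
      | hadd f₁ f₂ h₁ h₂ => simp only [add_mul, mul_add, h₁, h₂]
      | hs h₂ b =>
        induction k using induction with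
        | h0 => simp
        | hadd f₁ f₂ h₁ h₂ => simp only [mul_add, h₁, h₂]
        | hs h₃ c =>
          simp only [single_mul_single, map_mul, StarAlgEquiv.mul_apply, mul_assoc]

lemma star_add' (f g : TwistedAlg α) : star (f + g) = star f + star g :=
  Finsupp.sum_add_index' (by simp [single_zero])
    (fun h a b => by rw [star_add, map_add, single_add])

lemma star_zero' : star (0 : TwistedAlg α) = 0 := Finsupp.sum_zero_index

lemma apply_inv_apply (h : H) (a : A) : α h⁻¹ (α h a) = a := by
  rw [← StarAlgEquiv.mul_apply, ← map_mul, inv_mul_cancel, map_one, StarAlgEquiv.one_apply]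

lemma apply_apply_inv (h : H) (a : A) : α h (α h⁻¹ a) = a := by
  rw [← StarAlgEquiv.mul_apply, ← map_mul, mul_inv_cancel, map_one, StarAlgEquiv.one_apply]

instance : StarRing (TwistedAlg α) where
  star_involutive f := by
    induction f using induction with
    | h0 => simp only [star_zero']
    | hadd f g hf hg => simp only [star_add', hf, hg]
    | hs h a => simp only [star_single, map_star, star_star, inv_inv, apply_apply_inv]
  star_mul f g := by
    induction f using induction with
    | h0 => simp only [star_zero', zero_mul, mul_zero]
    | hadd f g hf hg => simp only [star_add', add_mul, mul_add, hf, hg]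
    | hs h a =>
      induction g using induction with
      | h0 => simp only [star_zero', zero_mul, mul_zero]
      | hadd f g hf hg => simp only [star_add', add_mul, mul_add, hf, hg]
      | hs k b =>
        simp only [star_single, single_mul_single, star_mul, mul_inv_rev, map_mul,
          StarAlgEquiv.mul_apply, ← map_star, apply_inv_apply]
  star_add := star_add'

instance : IsScalarTower ℂ (TwistedAlg α) (TwistedAlg α) where
  smul_assoc c f g := by
    simp only [smul_eq_mul]
    induction f using induction with
    | h0 => simp
    | hadd f g hf hg => simp only [smul_add, add_mul, hf, hg]
    | hs h a =>
      induction g using induction with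
      | h0 => simp
      | hadd f g hf hg => simp only [smul_add, mul_add, hf, hg]
      | hs k b => simp only [smul_single, single_mul_single, smul_mul_assoc]

instance : SMulCommClass ℂ (TwistedAlg α) (TwistedAlg α) where
  smul_comm c f g := by
    simp only [smul_eq_mul]
    induction f using induction with
    | h0 => simp
    | hadd f g hf hg => simp only [smul_add, add_mul, hf, hg]
    | hs h a =>
      induction g using induction with
      | h0 => simp
      | hadd f g hf hg => simp only [smul_add, mul_add, hf, hg]
      | hs k b => simp only [smul_single, single_mul_single, map_smul, mul_smul_comm]

instance : StarModule ℂ (TwistedAlg α) where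
  star_smul c f := by
    induction f using induction with
    | h0 => simp
    | hadd f g hf hg => simp only [smul_add, star_add, hf, hg]
    | hs h a => simp only [smul_single, star_single, star_smul, map_smul]

/-- The `ℓ¹`-norm on `C_c(H, A)`. -/
def l1norm (f : TwistedAlg α) : ℝ := Finsupp.sum f fun _ a => ‖a‖

/-- The C⋆-seminorms on `C_c(H, A)` that are dominated by the `ℓ¹`-norm. These are exactly the
seminorms `f ↦ ‖π(f)‖` for the ⋆-representations `π` of `C_c(H, A)`, or equivalently for the
integrated forms `π = ρ ⋊ u` of covariant representations: the `ℓ¹`-bound is automatic, because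
⋆-homomorphisms out of `A` are contractive. -/
structure IsCStarSeminorm (p : Seminorm ℂ (TwistedAlg α)) : Prop where
  mul_le : ∀ f g, p (f * g) ≤ p f * p g
  star_mul_self : ∀ f, p (star f * f) = p f * p f
  le_l1norm : ∀ f, p f ≤ l1norm f

lemma isCStarSeminorm_zero : IsCStarSeminorm (0 : Seminorm ℂ (TwistedAlg α)) where
  mul_le f g := by simp
  star_mul_self f := by simp
  le_l1norm f := by
    change (0 : ℝ) ≤ l1norm f
    exact Finset.sum_nonneg fun _ _ => norm_nonneg _

/-- The universal C⋆-norm on `C_c(H, A)`: the supremum of all C⋆-seminorms. The completion is thus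
the enveloping C⋆-algebra of `ℓ¹(H, A, α)`. -/
def univNorm (f : TwistedAlg α) : ℝ :=
  ⨆ p : {p : Seminorm ℂ (TwistedAlg α) // IsCStarSeminorm p}, p.1 f

instance : Nonempty {p : Seminorm ℂ (TwistedAlg α) // IsCStarSeminorm p} :=
  ⟨⟨0, isCStarSeminorm_zero⟩⟩

lemma bddAbove (f : TwistedAlg α) :
    BddAbove (Set.range fun p : {p : Seminorm ℂ (TwistedAlg α) // IsCStarSeminorm p} => p.1 f) :=
  ⟨l1norm f, by rintro _ ⟨p, rfl⟩; exact p.2.le_l1norm f⟩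

lemma le_univNorm {p : Seminorm ℂ (TwistedAlg α)} (hp : IsCStarSeminorm p) (f : TwistedAlg α) :
    p f ≤ univNorm f :=
  le_ciSup (bddAbove f) ⟨p, hp⟩

lemma univNorm_nonneg (f : TwistedAlg α) : 0 ≤ univNorm f :=
  (apply_nonneg (0 : Seminorm ℂ (TwistedAlg α)) f).trans (le_univNorm isCStarSeminorm_zero f)

lemma univNorm_le_l1norm (f : TwistedAlg α) : univNorm f ≤ l1norm f :=
  ciSup_le fun p => p.2.le_l1norm f

lemma univNorm_mul_le (f g : TwistedAlg α) : univNorm (f * g) ≤ univNorm f * univNorm g :=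
  ciSup_le fun p => (p.2.mul_le f g).trans (mul_le_mul (le_univNorm p.2 f) (le_univNorm p.2 g)
    (apply_nonneg _ _) (univNorm_nonneg f))

lemma univNorm_star_mul_self (f : TwistedAlg α) :
    univNorm (star f * f) = univNorm f * univNorm f := by
  refine le_antisymm (ciSup_le fun p => ?_) ?_
  · rw [p.2.star_mul_self]
    exact mul_le_mul (le_univNorm p.2 f) (le_univNorm p.2 f)
      (apply_nonneg _ _) (univNorm_nonneg f)
  · have h1 : univNorm f ≤ Real.sqrt (univNorm (star f * f)) := ciSup_le fun p => by
      refine Real.le_sqrt_of_sq_le ?_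
      rw [sq, ← p.2.star_mul_self]
      exact le_univNorm p.2 _
    calc univNorm f * univNorm f ≤ _ := mul_self_le_mul_self (univNorm_nonneg f) h1
      _ = _ := Real.mul_self_sqrt (univNorm_nonneg _)

/-- The universal C⋆-norm as a seminorm. -/
def univSeminorm : Seminorm ℂ (TwistedAlg α) :=
  Seminorm.of univNorm
    (fun f g => ciSup_le fun p => (map_add_le_add p.1 f g).trans
      (add_le_add (le_univNorm p.2 f) (le_univNorm p.2 g)))
    (fun c f => by
      simp only [univNorm, map_smul_eq_mul]
      exact (Real.mul_iSup_of_nonneg (norm_nonneg c) _).symm)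

instance : SeminormedAddCommGroup (TwistedAlg α) :=
  AddGroupSeminorm.toSeminormedAddCommGroup (univSeminorm (α := α)).toAddGroupSeminorm

lemma norm_def (f : TwistedAlg α) : ‖f‖ = univNorm f := rfl

instance : NonUnitalSeminormedRing (TwistedAlg α) where
  __ := (inferInstance : SeminormedAddCommGroup (TwistedAlg α))
  __ := (inferInstance : NonUnitalRing (TwistedAlg α))
  norm_mul_le := univNorm_mul_le

instance : NormedSpace ℂ (TwistedAlg α) where
  norm_smul_le c f := (map_smul_eq_mul (univSeminorm (α := α)) c f).le

lemma norm_star_mul_self' (f : TwistedAlg α) : ‖star f * f‖ = ‖f‖ * ‖f‖ :=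
  univNorm_star_mul_self f

lemma norm_star' (f : TwistedAlg α) : ‖star f‖ = ‖f‖ := by
  have key : ∀ f : TwistedAlg α, ‖f‖ ≤ ‖star f‖ := fun f => by
    rcases (norm_nonneg f).eq_or_lt with h | h
    · rw [← h]; exact norm_nonneg _
    · refine le_of_mul_le_mul_right ?_ h
      rw [← norm_star_mul_self']
      exact norm_mul_le _ _
  refine le_antisymm ?_ (key f)
  simpa using key (star f)

instance : NormedStarGroup (TwistedAlg α) where
  norm_star_le f := (norm_star' f).le

variable (α) in
/-- Left translation `f ↦ δ_g f`, i.e. `a δ_h ↦ α_g(a) δ_{gh}`. -/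
def leftMul (g : H) (f : TwistedAlg α) : TwistedAlg α :=
  Finsupp.sum f fun h a => single α (g * h) (α g a)

variable (α) in
/-- Right translation `f ↦ f δ_g`, i.e. `a δ_h ↦ a δ_{hg}`. -/
def rightMul (g : H) (f : TwistedAlg α) : TwistedAlg α :=
  Finsupp.sum f fun h a => single α (h * g) a

lemma leftMul_single (g h : H) (a : A) :
    leftMul α g (single α h a) = single α (g * h) (α g a) :=
  Finsupp.sum_single_index (by simp [single_zero])

lemma rightMul_single (g h : H) (a : A) :
    rightMul α g (single α h a) = single α (h * g) a :=
  Finsupp.sum_single_index (by simp [single_zero])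

lemma leftMul_zero (g : H) : leftMul α g 0 = 0 := Finsupp.sum_zero_index

lemma rightMul_zero (g : H) : rightMul α g 0 = 0 := Finsupp.sum_zero_index

lemma leftMul_add (g : H) (f k : TwistedAlg α) :
    leftMul α g (f + k) = leftMul α g f + leftMul α g k :=
  Finsupp.sum_add_index' (by simp [single_zero]) (fun h a b => by rw [map_add, single_add])

lemma rightMul_add (g : H) (f k : TwistedAlg α) :
    rightMul α g (f + k) = rightMul α g f + rightMul α g k :=
  Finsupp.sum_add_index' (by simp [single_zero]) (fun h a b => by rw [single_add])

lemma leftMul_smul (g : H) (c : ℂ) (f : TwistedAlg α) :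
    leftMul α g (c • f) = c • leftMul α g f := by
  induction f using induction with
  | h0 => simp [leftMul_zero]
  | hadd f g hf hg => simp only [smul_add, leftMul_add, hf, hg]
  | hs h a => simp only [smul_single, leftMul_single, map_smul]

lemma rightMul_smul (g : H) (c : ℂ) (f : TwistedAlg α) :
    rightMul α g (c • f) = c • rightMul α g f := by
  induction f using induction with
  | h0 => simp [rightMul_zero]
  | hadd f g hf hg => simp only [smul_add, rightMul_add, hf, hg]
  | hs h a => simp only [smul_single, rightMul_single]

lemma star_leftMul_mul_leftMul (g : H) (f k : TwistedAlg α) :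
    star (leftMul α g f) * leftMul α g k = star f * k := by
  induction f using induction with
  | h0 => simp [leftMul_zero]
  | hadd f g hf hg => simp only [leftMul_add, star_add, add_mul, hf, hg]
  | hs h a =>
    induction k using induction with
    | h0 => simp [leftMul_zero]
    | hadd f g hf hg => simp only [leftMul_add, mul_add, hf, hg]
    | hs k b =>
      have h1 : ∀ c : A, α (h⁻¹ * g⁻¹) (α g c) = α h⁻¹ c := fun c => by
        rw [map_mul, StarAlgEquiv.mul_apply, apply_inv_apply]
      simp only [leftMul_single, star_single, single_mul_single, mul_inv_rev, ← map_star, h1]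
      congr 1
      group

lemma star_rightMul (g : H) (f : TwistedAlg α) :
    star (rightMul α g f) = leftMul α g⁻¹ (star f) := by
  induction f using induction with
  | h0 => simp [leftMul_zero, rightMul_zero]
  | hadd f g hf hg => simp only [leftMul_add, rightMul_add, star_add, hf, hg]
  | hs h a =>
    simp only [leftMul_single, rightMul_single, star_single, mul_inv_rev, map_mul,
      StarAlgEquiv.mul_apply]

lemma norm_leftMul (g : H) (f : TwistedAlg α) : ‖leftMul α g f‖ = ‖f‖ := by
  have h := norm_star_mul_self' (leftMul α g f)
  rw [star_leftMul_mul_leftMul, norm_star_mul_self'] at h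
  exact (mul_self_inj_of_nonneg (norm_nonneg _) (norm_nonneg _)).1 h.symm

lemma norm_rightMul (g : H) (f : TwistedAlg α) : ‖rightMul α g f‖ = ‖f‖ := by
  rw [← norm_star', star_rightMul, norm_leftMul, norm_star']

lemma rightMul_mul (g : H) (f k : TwistedAlg α) :
    rightMul α g f * k = f * leftMul α g k := by
  induction f using induction with
  | h0 => simp [rightMul_zero]
  | hadd f g hf hg => simp only [rightMul_add, add_mul, hf, hg]
  | hs h a =>
    induction k using induction with
    | h0 => simp [leftMul_zero]
    | hadd f g hf hg => simp only [leftMul_add, mul_add, hf, hg]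
    | hs k b =>
      simp only [leftMul_single, rightMul_single, single_mul_single, map_mul,
        StarAlgEquiv.mul_apply, mul_assoc]

lemma leftMul_leftMul (g k : H) (f : TwistedAlg α) :
    leftMul α g (leftMul α k f) = leftMul α (g * k) f := by
  induction f using induction with
  | h0 => simp [leftMul_zero]
  | hadd f g hf hg => simp only [leftMul_add, hf, hg]
  | hs h a => simp only [leftMul_single, map_mul, StarAlgEquiv.mul_apply, mul_assoc]

lemma leftMul_one (f : TwistedAlg α) : leftMul α 1 f = f := by
  induction f using induction with
  | h0 => simp [leftMul_zero]
  | hadd f g hf hg => simp only [leftMul_add, hf, hg]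
  | hs h a => simp only [leftMul_single, map_one, StarAlgEquiv.one_apply, one_mul]

variable (α) in
/-- Left translation as a continuous linear map. -/
def leftMulCLM (g : H) : TwistedAlg α →L[ℂ] TwistedAlg α :=
  LinearMap.mkContinuous
    { toFun := leftMul α g, map_add' := leftMul_add g, map_smul' := leftMul_smul g } 1
    (fun f => by simpa using (norm_leftMul g f).le)

variable (α) in
/-- Right translation as a continuous linear map. -/
def rightMulCLM (g : H) : TwistedAlg α →L[ℂ] TwistedAlg α :=
  LinearMap.mkContinuous
    { toFun := rightMul α g, map_add' := rightMul_add g, map_smul' := rightMul_smul g } 1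
    (fun f => by simpa using (norm_rightMul g f).le)

end TwistedAlg

open UniformSpace

/-- The (full) crossed product `A ⋊_α H`: the completion of `C_c(H, A)` in the universal
C⋆-norm. -/
def CrossedProduct (α : H →* (A ≃⋆ₐ[ℂ] A)) : Type (max u v) := Completion (TwistedAlg α)

namespace CrossedProduct

variable {α : H →* (A ≃⋆ₐ[ℂ] A)}

instance : NormedAddCommGroup (CrossedProduct α) :=
  inferInstanceAs (NormedAddCommGroup (Completion (TwistedAlg α)))

instance : NormedSpace ℂ (CrossedProduct α) :=
  inferInstanceAs (NormedSpace ℂ (Completion (TwistedAlg α)))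

instance : CompleteSpace (CrossedProduct α) :=
  inferInstanceAs (CompleteSpace (Completion (TwistedAlg α)))

/-- The canonical map `C_c(H, A) → A ⋊_α H`. -/
def of (f : TwistedAlg α) : CrossedProduct α := (f : Completion (TwistedAlg α))

lemma continuous_of : Continuous (of : TwistedAlg α → CrossedProduct α) :=
  Completion.continuous_coe _

lemma denseRange_of : DenseRange (of : TwistedAlg α → CrossedProduct α) :=
  Completion.denseRange_coe

lemma norm_of (f : TwistedAlg α) : ‖of f‖ = ‖f‖ := Completion.norm_coe f

lemma of_add (f g : TwistedAlg α) : of (f + g) = of f + of g := Completion.coe_add f g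

lemma of_zero : of (0 : TwistedAlg α) = 0 := Completion.coe_zero

lemma of_smul (c : ℂ) (f : TwistedAlg α) : of (c • f) = c • of f := Completion.coe_smul c f

/-- The continuous extension of the multiplication of `C_c(H, A)`. -/
instance : Mul (CrossedProduct α) where
  mul := Function.curry <|
    ((Completion.isDenseInducing_coe (α := TwistedAlg α)).prodMap
      (Completion.isDenseInducing_coe (α := TwistedAlg α))).extend
      (of ∘ Function.uncurry (· * ·))

/-- The continuous extension of the involution of `C_c(H, A)`. -/
instance : Star (CrossedProduct α) where
  star := Completion.map (star : TwistedAlg α → TwistedAlg α)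

lemma of_mul (f g : TwistedAlg α) : of (f * g) = of f * of g :=
  (((Completion.isDenseInducing_coe (α := TwistedAlg α)).prodMap
      (Completion.isDenseInducing_coe (α := TwistedAlg α))).extend_eq
      (continuous_of.comp (continuous_mul (M := TwistedAlg α))) (f, g)).symm

lemma of_star (f : TwistedAlg α) : of (star f) = star (of f) :=
  (Completion.map_coe (starNormedAddGroupHom (E := TwistedAlg α)).uniformContinuous f).symm

instance : ContinuousMul (CrossedProduct α) where
  continuous_mul := by
    let m := (AddMonoidHom.mul : TwistedAlg α →+ TwistedAlg α →+ TwistedAlg α).compr₂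
      (Completion.toCompl : TwistedAlg α →+ Completion (TwistedAlg α))
    have : Continuous fun p : TwistedAlg α × TwistedAlg α => m p.1 p.2 :=
      continuous_of.comp continuous_mul
    have di : IsDenseInducing (Completion.toCompl : TwistedAlg α → Completion (TwistedAlg α)) :=
      Completion.isDenseInducing_coe
    exact (di.extend_Z_bilin di this :)

lemma continuous_star' : Continuous (star : CrossedProduct α → CrossedProduct α) :=
  Completion.continuous_map

instance : NonUnitalNormedRing (CrossedProduct α) where
  __ := (inferInstance : NormedAddCommGroup (CrossedProduct α))
  __ := (inferInstance : Mul (CrossedProduct α))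
  left_distrib a b c :=
    denseRange_of.induction_on₃ (p := fun a b c : CrossedProduct α => a * (b + c) = a * b + a * c)
      (isClosed_eq (by fun_prop) (by fun_prop))
      (fun a b c => by simp only [← of_add, ← of_mul, mul_add]) a b c
  right_distrib a b c :=
    denseRange_of.induction_on₃ (p := fun a b c : CrossedProduct α => (a + b) * c = a * c + b * c)
      (isClosed_eq (by fun_prop) (by fun_prop))
      (fun a b c => by simp only [← of_add, ← of_mul, add_mul]) a b c
  zero_mul a :=
    denseRange_of.induction_on (p := fun a : CrossedProduct α => 0 * a = 0) a
      (isClosed_eq (by fun_prop) (by fun_prop))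
      (fun a => by rw [← of_zero, ← of_mul, zero_mul])
  mul_zero a :=
    denseRange_of.induction_on (p := fun a : CrossedProduct α => a * 0 = 0) a
      (isClosed_eq (by fun_prop) (by fun_prop))
      (fun a => by rw [← of_zero, ← of_mul, mul_zero])
  mul_assoc a b c :=
    denseRange_of.induction_on₃ (p := fun a b c : CrossedProduct α => a * b * c = a * (b * c))
      (isClosed_eq (by fun_prop) (by fun_prop))
      (fun a b c => by simp only [← of_mul, mul_assoc]) a b c
  norm_mul_le a b :=
    denseRange_of.induction_on₂ (p := fun a b : CrossedProduct α => ‖a * b‖ ≤ ‖a‖ * ‖b‖)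
      (isClosed_le (by fun_prop) (by fun_prop))
      (fun a b => by simpa only [← of_mul, norm_of] using norm_mul_le a b) a b

instance : StarRing (CrossedProduct α) where
  star_involutive a :=
    denseRange_of.induction_on (p := fun a : CrossedProduct α => star (star a) = a) a
      (isClosed_eq (continuous_star'.comp continuous_star') continuous_id)
      (fun a => by simp only [← of_star, star_star])
  star_mul a b :=
    denseRange_of.induction_on₂
      (p := fun a b : CrossedProduct α => star (a * b) = star b * star a)
      (isClosed_eq (continuous_star'.comp continuous_mul)
        ((continuous_star'.comp continuous_snd).mul (continuous_star'.comp continuous_fst)))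
      (fun a b => by simp only [← of_star, ← of_mul, star_mul]) a b
  star_add a b :=
    denseRange_of.induction_on₂
      (p := fun a b : CrossedProduct α => star (a + b) = star a + star b)
      (isClosed_eq (continuous_star'.comp continuous_add)
        ((continuous_star'.comp continuous_fst).add (continuous_star'.comp continuous_snd)))
      (fun a b => by simp only [← of_star, ← of_add, star_add]) a b

instance : CStarRing (CrossedProduct α) where
  norm_mul_self_le a :=
    denseRange_of.induction_on (p := fun a : CrossedProduct α => ‖a‖ * ‖a‖ ≤ ‖star a * a‖) a
      (isClosed_le (by fun_prop) ((continuous_star'.mul continuous_id).norm))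
      (fun a => by
        rw [← of_star, ← of_mul, norm_of, norm_of, TwistedAlg.norm_star_mul_self'])

instance : IsScalarTower ℂ (CrossedProduct α) (CrossedProduct α) where
  smul_assoc c a b :=
    denseRange_of.induction_on₂ (p := fun a b : CrossedProduct α => (c • a) * b = c • (a * b))
      (isClosed_eq ((continuous_fst.const_smul c).mul continuous_snd)
        ((continuous_fst.mul continuous_snd).const_smul c))
      (fun a b => by rw [← of_smul, ← of_mul, ← of_mul, ← of_smul, smul_mul_assoc]) a b

instance : SMulCommClass ℂ (CrossedProduct α) (CrossedProduct α) where
  smul_comm c a b :=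
    denseRange_of.induction_on₂ (p := fun a b : CrossedProduct α => c • (a * b) = a * (c • b))
      (isClosed_eq ((continuous_fst.mul continuous_snd).const_smul c)
        (continuous_fst.mul (continuous_snd.const_smul c)))
      (fun a b => by rw [← of_smul, ← of_mul, ← of_mul, ← of_smul, mul_smul_comm]) a b

instance : StarModule ℂ (CrossedProduct α) where
  star_smul c a :=
    denseRange_of.induction_on (p := fun a : CrossedProduct α => star (c • a) = star c • star a) a
      (isClosed_eq (continuous_star'.comp (continuous_id.const_smul c))
        ((continuous_const_smul (star c)).comp continuous_star'))
      (fun a => by rw [← of_smul, ← of_star, ← of_star, ← of_smul, star_smul])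

instance : NonUnitalCStarAlgebra (CrossedProduct α) where

variable (α) in
/-- The canonical embedding `ι_A : A → A ⋊_α H`, `a ↦ a δ_e`. -/
def incl : A →⋆ₙₐ[ℂ] CrossedProduct α where
  toFun a := of (TwistedAlg.single α 1 a)
  map_smul' c a := by
    rw [← TwistedAlg.smul_single, of_smul]; rfl
  map_zero' := by rw [TwistedAlg.single_zero, of_zero]
  map_add' a b := by rw [TwistedAlg.single_add, of_add]
  map_mul' a b := by
    rw [← of_mul, TwistedAlg.single_mul_single, map_one, StarAlgEquiv.one_apply, one_mul]
  map_star' a := by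
    rw [← of_star, TwistedAlg.star_single, inv_one, map_one, StarAlgEquiv.one_apply]

variable (α) in
/-- The continuous extension to `A ⋊_α H` of left translation on `C_c(H, A)`. -/
def leftMul (g : H) : CrossedProduct α →L[ℂ] CrossedProduct α :=
  (TwistedAlg.leftMulCLM α g).completion

variable (α) in
/-- The continuous extension to `A ⋊_α H` of right translation on `C_c(H, A)`. -/
def rightMul (g : H) : CrossedProduct α →L[ℂ] CrossedProduct α :=
  (TwistedAlg.rightMulCLM α g).completion

lemma leftMul_of (g : H) (f : TwistedAlg α) :
    leftMul α g (of f) = of (TwistedAlg.leftMul α g f) :=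
  (TwistedAlg.leftMulCLM α g).completion_apply_coe f

lemma rightMul_of (g : H) (f : TwistedAlg α) :
    rightMul α g (of f) = of (TwistedAlg.rightMul α g f) :=
  (TwistedAlg.rightMulCLM α g).completion_apply_coe f

lemma rightMul_mul (g : H) (x y : CrossedProduct α) :
    rightMul α g x * y = x * leftMul α g y :=
  denseRange_of.induction_on₂
    (p := fun x y : CrossedProduct α => rightMul α g x * y = x * leftMul α g y)
    (isClosed_eq (((rightMul α g).continuous.comp continuous_fst).mul continuous_snd)
      (continuous_fst.mul ((leftMul α g).continuous.comp continuous_snd)))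
    (fun x y => by rw [leftMul_of, rightMul_of, ← of_mul, ← of_mul, TwistedAlg.rightMul_mul]) x y

lemma leftMul_leftMul (g k : H) (x : CrossedProduct α) :
    leftMul α g (leftMul α k x) = leftMul α (g * k) x :=
  denseRange_of.induction_on
    (p := fun x : CrossedProduct α => leftMul α g (leftMul α k x) = leftMul α (g * k) x) x
    (isClosed_eq ((leftMul α g).continuous.comp (leftMul α k).continuous)
      (leftMul α (g * k)).continuous)
    (fun x => by simp only [leftMul_of, TwistedAlg.leftMul_leftMul])

lemma leftMul_one (x : CrossedProduct α) : leftMul α 1 x = x :=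
  denseRange_of.induction_on (p := fun x : CrossedProduct α => leftMul α 1 x = x) x
    (isClosed_eq (leftMul α 1).continuous continuous_id)
    (fun x => by rw [leftMul_of, TwistedAlg.leftMul_one])

lemma star_rightMul (g : H) (x : CrossedProduct α) :
    star (rightMul α g x) = leftMul α g⁻¹ (star x) :=
  denseRange_of.induction_on
    (p := fun x : CrossedProduct α => star (rightMul α g x) = leftMul α g⁻¹ (star x)) x
    (isClosed_eq (continuous_star'.comp (rightMul α g).continuous)
      ((leftMul α g⁻¹).continuous.comp continuous_star'))
    (fun x => by rw [rightMul_of, ← of_star, ← of_star, leftMul_of, TwistedAlg.star_rightMul])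

variable (α) in
/-- The multiplier `λ_g` of `A ⋊_α H`, given on `C_c(H, A)` by left and right translation:
`λ_g (a δ_h) = α_g(a) δ_{gh}` and `(a δ_h) λ_g = a δ_{hg}`. -/
def lambdaMul (g : H) : 𝓜(ℂ, CrossedProduct α) where
  fst := leftMul α g
  snd := rightMul α g
  central := rightMul_mul g

/-- Multipliers are determined by their left actions. -/
lemma ext_of_fst {B : Type*} [NonUnitalCStarAlgebra B] {m n : 𝓜(ℂ, B)}
    (h : ∀ x, m.fst x = n.fst x) : m = n := by
  ext x
  · exact h x
  · refine star_injective (eq_of_forall_mul_left fun z => star_injective ?_)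
    rw [star_mul, star_mul, star_star, star_star, m.central, n.central, h]

lemma lambdaMul_mul (g k : H) : lambdaMul α (g * k) = lambdaMul α g * lambdaMul α k :=
  ext_of_fst fun x => (leftMul_leftMul g k x).symm

lemma lambdaMul_one : lambdaMul α 1 = 1 := ext_of_fst leftMul_one

lemma star_lambdaMul (g : H) : star (lambdaMul α g) = lambdaMul α g⁻¹ :=
  ext_of_fst fun x => by
    rw [DoubleCentralizer.star_fst]
    change star (rightMul α g (star x)) = leftMul α g⁻¹ x
    rw [star_rightMul, star_star]

variable (α) in
/-- The canonical unitary representation `λ^α : H → U(M(A ⋊_α H))`. -/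
def lambda : H →* unitary 𝓜(ℂ, CrossedProduct α) where
  toFun g := ⟨lambdaMul α g, by
    rw [Unitary.mem_iff, star_lambdaMul, ← lambdaMul_mul, ← lambdaMul_mul, inv_mul_cancel,
      mul_inv_cancel, lambdaMul_one]
    exact ⟨rfl, rfl⟩⟩
  map_one' := Subtype.ext lambdaMul_one
  map_mul' g k := Subtype.ext (lambdaMul_mul g k)

/-- `ι_A(α_g(a)) = λ_g ι_A(a) λ_g⋆`. -/
lemma incl_equivariant (g : H) (a : A) :
    incl α (α g a) = ad (lambda α g) (incl α a) := by
  change of (TwistedAlg.single α 1 (α g a)) =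
    (lambdaMul α g).fst ((star (lambdaMul α g)).snd (of (TwistedAlg.single α 1 a)))
  rw [star_lambdaMul]
  change _ = leftMul α g (rightMul α g⁻¹ (of (TwistedAlg.single α 1 a)))
  rw [rightMul_of, leftMul_of, TwistedAlg.rightMul_single, TwistedAlg.leftMul_single, one_mul,
    mul_inv_cancel]

end CrossedProduct

end CrossedProduct

/-! ### Equivariantly sequentially split homomorphisms -/

section SequentiallySplit

variable {G : Type v} [Group G]
variable {A : Type u} {B : Type*} [NonUnitalCStarAlgebra A] [NonUnitalCStarAlgebra B]

/-- An equivariant ⋆-homomorphism `(A, α) → (B, β)` between C⋆-algebras with `G`-actions. -/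
structure EquivariantStarHom (α : G →* (A ≃⋆ₐ[ℂ] A)) (β : G →* (B ≃⋆ₐ[ℂ] B)) where
  /-- The underlying ⋆-homomorphism. -/
  toHom : A →⋆ₙₐ[ℂ] B
  equivariant : ∀ (g : G) (a : A), toHom (α g a) = β g (toHom a)

/-- The action `α_∞` on the sequence algebra `A_∞` by componentwise application of `α`. -/
def seqAction (α : G →* (A ≃⋆ₐ[ℂ] A)) : G →* (SeqAlg A ≃⋆ₐ[ℂ] SeqAlg A) :=
  SeqAlg.aut.comp α

/-- The extension `α̃_∞` to `M(D_{∞,A})` of the action on `D_{∞,A}` given by restricting `α_∞`. -/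
def multAction (α : G →* (A ≃⋆ₐ[ℂ] A)) :
    G →* (𝓜(ℂ, DAlg A) ≃⋆ₐ[ℂ] 𝓜(ℂ, DAlg A)) :=
  multiplierAut.comp (DAlg.aut.comp α)

/-- The continuous part `A_{∞,α}` of `A_∞`, i.e. the set of `x` for which `g ↦ α_{∞,g}(x)` is
continuous. For discrete groups, this is all of `A_∞`. -/
def seqContinuousPart [TopologicalSpace G] (α : G →* (A ≃⋆ₐ[ℂ] A)) : Set (SeqAlg A) :=
  {x | Continuous fun g => seqAction α g x}

/-- An equivariant ⋆-homomorphism `φ : (A, α) → (B, β)` is equivariantly sequentially split if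
there is an equivariant ⋆-homomorphism `ψ : (B, β) → (A_{∞,α}, α_∞)` such that `ψ ∘ φ` is the
canonical embedding of `A` as constant sequences. -/
def IsEquivariantlySequentiallySplit [TopologicalSpace G] {α : G →* (A ≃⋆ₐ[ℂ] A)}
    {β : G →* (B ≃⋆ₐ[ℂ] B)} (φ : EquivariantStarHom α β) : Prop :=
  ∃ ψ : EquivariantStarHom β (seqAction α),
    (∀ b, ψ.toHom b ∈ seqContinuousPart α) ∧ ∀ a, ψ.toHom (φ.toHom a) = SeqAlg.const a

/-- The canonical inclusion `ι_A : (A, α) → (A ⋊_α H, ad(λ^α))`. -/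
def crossedInclusion (α : G →* (A ≃⋆ₐ[ℂ] A)) :
    EquivariantStarHom α (ad.comp (CrossedProduct.lambda α)) where
  toHom := CrossedProduct.incl α
  equivariant := CrossedProduct.incl_equivariant

/-! ### Approximate representability -/

/-- An action `α` of a discrete group on a C⋆-algebra `A` is approximately representable if there
are contractions `x_{n,h} ∈ A` with the following four properties. -/
def IsApproximatelyRepresentable (α : G →* (A ≃⋆ₐ[ℂ] A)) : Prop :=
  ∃ x : ℕ → G → A, (∀ n h, ‖x n h‖ ≤ 1) ∧
    (∀ h, (map (fun n => x n h * star (x n h)) atTop).IsApproximateUnit ∧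
      (map (fun n => star (x n h) * x n h) atTop).IsApproximateUnit) ∧
    (∀ g h a, Tendsto (fun n => ‖a * (x n g * x n h - x n (g * h))‖ +
      ‖(x n g * x n h - x n (g * h)) * a‖) atTop (𝓝 0)) ∧
    (∀ a h, Tendsto (fun n => ‖α h a - x n h * a * star (x n h)‖) atTop (𝓝 0)) ∧
    (∀ g h a, Tendsto (fun n => ‖a * (x n (g * h * g⁻¹) - α g (x n h))‖ +
      ‖(x n (g * h * g⁻¹) - α g (x n h)) * a‖) atTop (𝓝 0))

end SequentiallySplit

end CStarDyn

end

noncomputable section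

namespace CStarDyn

open Filter Topology
open scoped ENNReal MultiplierAlgebra

universe u v

/-! ### The sequence algebra -/

section SequenceAlgebra

variable {A : Type u} [NonUnitalCStarAlgebra A]

/-! The three conditions describe one object at three levels: a representation of `H` by elements
that implement `α`, found asymptotically in `A`, as multipliers of `D_{∞,A}`, or inside a copy of `A
⋊_α H`. The equivalence is proved as a cycle (i) → (ii) → (iii) → (i).

(i) → (ii). The class `z_h` of `(x_{n,h})_n` in `A_∞` satisfies every relation of a unitary
representation implementing `α`, but only after multiplication by constants from `A`. From `z_h a
z_h* = α_h(a)` and `a z_h* z_h = a` one gets `z_h a = α_h(a) z_h`. A constant can thus be moved past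
`z_h`, so `z_h` multiplies `D_{∞,A}` into itself and defines a multiplier. Elements of `D_{∞,A}` are
limits of sums of products `a x b`, so relations that hold against constants hold exactly for these
multipliers (`exists_seqAlg`, `exists_unitary`).

(ii) → (iii). The embedding of `A` into `D_{∞,A}` and `w` form a covariant pair. Its integrated form
`a δ_h ↦ a w_h` is bounded by the `ℓ¹`-norm, hence by the universal norm, and extends to the crossed
product (`TwistedAlg.norm_starAlgHom_le`, `CrossedProduct.lift`). On the generators `a δ_h`,
equivariance is the conjugation rule `α̃_g(w_h) = w_{ghg⁻¹}`.

(iii) → (i). Since `A` may lack a unit, `δ_h` itself need not lie in `A ⋊_α H`; it is replaced by `e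
δ_h` with `e` far along an approximate unit of `A`. The elements `ψ(e δ_h)` satisfy the required
relations in `A_∞` up to errors that vanish along the approximate unit (`tendsto_defect`). For
finitely many relations and a given tolerance, representing sequences of contractions satisfy them
at a late enough coordinate. Separability of `A` and countability of `H` then allow a diagonal
choice (`IsApproximatelyRepresentable.of_forall_finset`). -/

/-- A sequence of contractions, as a bounded sequence. -/
def bddSeqOfLEOne (x : ℕ → A) (hx : ∀ n, ‖x n‖ ≤ 1) : BddSeq A :=
  ⟨x, memℓp_infty ⟨1, by rintro _ ⟨n, rfl⟩; exact hx n⟩⟩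

lemma SeqAlg.mk_eq_mk_of_tendsto {x y : BddSeq A}
    (h : Tendsto (fun n => ‖x n - y n‖) atTop (𝓝 0)) : SeqAlg.mk x = SeqAlg.mk y := by
  rw [SeqAlg.mk_eq_mk, mem_nullSeq]
  exact tendsto_zero_iff_norm_tendsto_zero.2 h

/-- In a generator `a z b` of `D_{∞,A}` the factor next to `x` and `y` is a constant, so agreement
against constants is enough; linearity and continuity do the rest. -/
lemma mul_eq_mul_of_mem_DAlg {x y : SeqAlg A}
    (h : ∀ a, x * SeqAlg.const a = y * SeqAlg.const a) {d : SeqAlg A} (hd : d ∈ DAlg A) :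
    x * d = y * d := by
  refine sandwichSpan_induction (p := fun d => x * d = y * d)
    (isClosed_eq (continuous_const_mul x) (continuous_const_mul y)) (by simp)
    (fun _ _ h1 h2 => by rw [mul_add, mul_add, h1, h2])
    (fun c _ h => by rw [mul_smul_comm, mul_smul_comm, h]) ?_ (mem_DAlg.1 hd)
  rintro _ ⟨a, z, b, rfl⟩
  simp only [← mul_assoc, h]

/-- If `x a = b y`, then `x (a z c) = b (y z) c` is again a generator: a constant reappears on the
far left. -/
lemma mul_mem_DAlg_of_forall {x : SeqAlg A}
    (h : ∀ a, ∃ b y, x * SeqAlg.const a = SeqAlg.const b * y) {d : SeqAlg A} (hd : d ∈ DAlg A) :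
    x * d ∈ DAlg A := by
  refine sandwichSpan_induction (p := fun d => x * d ∈ sandwichSpan A)
    (isClosed_sandwichSpan.preimage (continuous_const_mul x)) (by simp)
    (fun _ _ h1 h2 => by rw [mul_add]; exact add_mem h1 h2)
    (fun c _ h => by rw [mul_smul_comm]; exact Submodule.smul_mem _ c h) ?_ (mem_DAlg.1 hd)
  rintro _ ⟨a, z, b, rfl⟩
  obtain ⟨c, y, hc⟩ := h a
  exact sandwich_subset ⟨c, y * z, b, by simp only [← mul_assoc, hc]⟩

lemma mul_mem_DAlg_of_forall' {x : SeqAlg A}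
    (h : ∀ a, ∃ b y, SeqAlg.const a * x = y * SeqAlg.const b) {d : SeqAlg A} (hd : d ∈ DAlg A) :
    d * x ∈ DAlg A := by
  have h1 : star x * star d ∈ DAlg A := by
    refine mul_mem_DAlg_of_forall (fun a => ?_) (star_mem hd)
    obtain ⟨b, y, hb⟩ := h (star a)
    refine ⟨star b, star y, ?_⟩
    have := congrArg star hb
    simpa [map_star] using this
  simpa using star_mem h1

/-- An element of `A_∞` that multiplies `D_{∞,A}` into itself, as a multiplier of `D_{∞,A}`. -/
def DAlg.multiplier (x : SeqAlg A) (hl : ∀ d ∈ DAlg A, x * d ∈ DAlg A)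
    (hr : ∀ d ∈ DAlg A, d * x ∈ DAlg A) : 𝓜(ℂ, DAlg A) where
  fst := LinearMap.mkContinuous
    { toFun := fun d => ⟨x * d, hl d d.2⟩
      map_add' := fun d e => Subtype.ext (mul_add x (d : SeqAlg A) e)
      map_smul' := fun c d => Subtype.ext (mul_smul_comm c x (d : SeqAlg A)) } ‖x‖
    (fun d => norm_mul_le x (d : SeqAlg A))
  snd := LinearMap.mkContinuous
    { toFun := fun d => ⟨d * x, hr d d.2⟩
      map_add' := fun d e => Subtype.ext (add_mul (d : SeqAlg A) e x)
      map_smul' := fun c d => Subtype.ext (smul_mul_assoc c (d : SeqAlg A) x) } ‖x‖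
    (fun d => by rw [mul_comm]; exact norm_mul_le (d : SeqAlg A) x)
  central d e := Subtype.ext (mul_assoc (d : SeqAlg A) x e)

lemma DAlg.coe_star_multiplier_fst {x : SeqAlg A} (hl : ∀ d ∈ DAlg A, x * d ∈ DAlg A)
    (hr : ∀ d ∈ DAlg A, d * x ∈ DAlg A) (d : DAlg A) :
    ((star (DAlg.multiplier x hl hr)).fst d : SeqAlg A) = star x * d := by
  rw [DoubleCentralizer.star_fst]
  change star (star (d : SeqAlg A) * x) = star x * d
  rw [star_mul, star_star]

end SequenceAlgebra

/-! ### Approximate representability yields a representation by multipliers -/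

section Multipliers

variable {A : Type u} [NonUnitalCStarAlgebra A] {H : Type v} [Group H]
  {α : H →* (A ≃⋆ₐ[ℂ] A)}

/-- Null sequences vanish in `A_∞`, so the limits become identities there. For the product and
conjugation relations only multiplication by `a` on the right is recorded, because a multiplier is
determined by its left action; the identity with `a` on the left of `z_h* z_h` serves to derive `z_h
a = α_h(a) z_h`. -/
lemma IsApproximatelyRepresentable.exists_seqAlg (hα : IsApproximatelyRepresentable α) :
    ∃ z : H → SeqAlg A,
      (∀ h a, z h * star (z h) * SeqAlg.const a = SeqAlg.const a) ∧
      (∀ h a, star (z h) * z h * SeqAlg.const a = SeqAlg.const a) ∧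
      (∀ h a, SeqAlg.const a * (star (z h) * z h) = SeqAlg.const a) ∧
      (∀ g h a, z g * z h * SeqAlg.const a = z (g * h) * SeqAlg.const a) ∧
      (∀ h a, SeqAlg.const (α h a) = z h * SeqAlg.const a * star (z h)) ∧
      (∀ g h a, z (g * h * g⁻¹) * SeqAlg.const a = seqAction α g (z h) * SeqAlg.const a) := by
  obtain ⟨x, hx, h1, h2, h3, h4⟩ := hα
  have key : ∀ {f : ℕ → A} {a : A}, Tendsto f atTop (𝓝 a) →
      Tendsto (fun n => ‖f n - a‖) atTop (𝓝 0) := fun hf =>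
    tendsto_iff_norm_sub_tendsto_zero.1 hf
  refine ⟨fun h => SeqAlg.mk (bddSeqOfLEOne (fun n => x n h) fun n => hx n h),
    fun h a => ?_, fun h a => ?_, fun h a => ?_, fun g h a => ?_, fun h a => ?_, fun g h a => ?_⟩
  · exact SeqAlg.mk_eq_mk_of_tendsto
      (key (tendsto_map'_iff.1 ((h1 h).1.tendsto_mul_right a)))
  · exact SeqAlg.mk_eq_mk_of_tendsto
      (key (tendsto_map'_iff.1 ((h1 h).2.tendsto_mul_right a)))
  · exact SeqAlg.mk_eq_mk_of_tendsto
      (key (tendsto_map'_iff.1 ((h1 h).2.tendsto_mul_left a)))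
  · refine SeqAlg.mk_eq_mk_of_tendsto (squeeze_zero (fun _ => norm_nonneg _) (fun n => ?_)
      (h2 g h a))
    change ‖x n g * x n h * a - x n (g * h) * a‖ ≤ _
    rw [← sub_mul]
    exact le_add_of_nonneg_left (norm_nonneg _)
  · exact SeqAlg.mk_eq_mk_of_tendsto (h3 a h)
  · refine SeqAlg.mk_eq_mk_of_tendsto (squeeze_zero (fun _ => norm_nonneg _) (fun n => ?_)
      (h4 g h a))
    change ‖x n (g * h * g⁻¹) * a - α g (x n h) * a‖ ≤ _
    rw [← sub_mul]
    exact le_add_of_nonneg_left (norm_nonneg _)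

theorem IsApproximatelyRepresentable.exists_unitary (hα : IsApproximatelyRepresentable α) :
    ∃ w : H →* unitary 𝓜(ℂ, DAlg A),
      (∀ (h : H) (a : A), (DAlg.const (α h a) : 𝓜(ℂ, DAlg A)) =
        (w h : 𝓜(ℂ, DAlg A)) * DAlg.const a * star (w h : 𝓜(ℂ, DAlg A))) ∧
      ∀ g h : H, multAction α h (w g) = w (h * g * h⁻¹) := by
  obtain ⟨z, h1, h2, h2', h3, h4, h5⟩ := hα.exists_seqAlg
  -- `α_h(a) z_h = z_h a z_h* z_h = z_h a`.
  have hcomm : ∀ h a, z h * SeqAlg.const a = SeqAlg.const (α h a) * z h := fun h a => by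
    rw [h4, mul_assoc, mul_assoc, h2']
  have hl : ∀ h, ∀ d ∈ DAlg A, z h * d ∈ DAlg A := fun h d hd =>
    mul_mem_DAlg_of_forall (fun a => ⟨_, _, hcomm h a⟩) hd
  have hr : ∀ h, ∀ d ∈ DAlg A, d * z h ∈ DAlg A := fun h d hd =>
    mul_mem_DAlg_of_forall' (fun a => ⟨α h⁻¹ a, z h, by
      rw [hcomm, TwistedAlg.apply_apply_inv]⟩) hd
  let m : H → 𝓜(ℂ, DAlg A) := fun h => DAlg.multiplier (z h) (hl h) (hr h)
  have hm : ∀ h d, ((m h).fst d : SeqAlg A) = z h * d := fun _ _ => rfl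
  have hsm : ∀ h d, ((star (m h)).fst d : SeqAlg A) = star (z h) * d := fun h d =>
    DAlg.coe_star_multiplier_fst _ _ d
  have hmul : ∀ g h, m (g * h) = m g * m h := fun g h =>
    CrossedProduct.ext_of_fst fun d => Subtype.ext <| by
      change z (g * h) * (d : SeqAlg A) = z g * (z h * d)
      rw [← mul_assoc]
      exact (mul_eq_mul_of_mem_DAlg (h3 g h) d.2).symm
  -- `A_∞` need not have a unit to compare `y` with, so `mul_eq_mul_of_mem_DAlg` does not apply and
  -- its argument is repeated.
  have hcancel : ∀ {y : SeqAlg A}, (∀ a, y * SeqAlg.const a = SeqAlg.const a) →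
      ∀ d ∈ DAlg A, y * d = d := fun {y} hy d hd => by
    refine sandwichSpan_induction (p := fun d => y * d = d)
      (isClosed_eq (continuous_const_mul y) continuous_id) (by simp)
      (fun _ _ h1 h2 => by rw [mul_add, h1, h2])
      (fun c _ h => by rw [mul_smul_comm, h]) ?_ (mem_DAlg.1 hd)
    rintro _ ⟨a, z, b, rfl⟩
    simp only [← mul_assoc, hy]
  have hss : ∀ h, star (m h) * m h = 1 := fun h =>
    CrossedProduct.ext_of_fst fun d => Subtype.ext <| by
      change ((star (m h)).fst ((m h).fst d) : SeqAlg A) = d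
      rw [hsm, hm, ← mul_assoc, hcancel (h2 h) d d.2]
  have hss' : ∀ h, m h * star (m h) = 1 := fun h =>
    CrossedProduct.ext_of_fst fun d => Subtype.ext <| by
      change ((m h).fst ((star (m h)).fst d) : SeqAlg A) = d
      rw [hm, hsm, ← mul_assoc, hcancel (h1 h) d d.2]
  let w : H →* unitary 𝓜(ℂ, DAlg A) := 
    MonoidHom.mk' (fun h => ⟨m h, hss h, hss' h⟩) fun g h => Subtype.ext (hmul g h)
  refine ⟨w, fun h a => ?_, fun g h => ?_⟩
  · refine CrossedProduct.ext_of_fst fun d => Subtype.ext ?_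
    change SeqAlg.const (α h a) * (d : SeqAlg A) =
      z h * (SeqAlg.const a * ((star (m h)).fst d : SeqAlg A))
    rw [hsm, h4]
    simp only [mul_assoc]
  · refine CrossedProduct.ext_of_fst fun d => Subtype.ext ?_
    -- The extended automorphism sends the left action `L` of a multiplier to `σ L σ⁻¹`, here with
    -- `σ` induced by `α h`.
    change seqAction α h (z g * SeqAlg.aut (α h)⁻¹ (d : SeqAlg A)) = z (h * g * h⁻¹) * d
    rw [map_mul]
    have hd : seqAction α h (SeqAlg.aut (α h)⁻¹ (d : SeqAlg A)) = d := by
      change (SeqAlg.aut (α h) * SeqAlg.aut (α h)⁻¹) (d : SeqAlg A) = d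
      rw [← map_mul, mul_inv_cancel, map_one, StarAlgEquiv.one_apply]
    rw [hd]
    exact (mul_eq_mul_of_mem_DAlg (h5 h g) d.2).symm

end Multipliers

/-! ### The universal property of the crossed product -/

section UniversalProperty

variable {A : Type u} [NonUnitalCStarAlgebra A] {H : Type v} [Group H]
  {α : H →* (A ≃⋆ₐ[ℂ] A)}

lemma CrossedProduct.norm_of_single_le (h : H) (a : A) :
    ‖of (TwistedAlg.single α h a)‖ ≤ ‖a‖ := by
  rw [norm_of]
  refine (TwistedAlg.univNorm_le_l1norm _).trans (le_of_eq ?_)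
  exact Finsupp.sum_single_index norm_zero

lemma CrossedProduct.ad_lambda_of_single (g h : H) (a : A) :
    ad (lambda α g) (of (TwistedAlg.single α h a)) =
      of (TwistedAlg.single α (g * h * g⁻¹) (α g a)) := by
  change (lambdaMul α g).fst ((star (lambdaMul α g)).snd (of (TwistedAlg.single α h a))) = _
  rw [star_lambdaMul]
  change leftMul α g (rightMul α g⁻¹ (of (TwistedAlg.single α h a))) = _
  rw [rightMul_of, leftMul_of, TwistedAlg.rightMul_single, TwistedAlg.leftMul_single, mul_assoc]

variable {B : Type*} [NonUnitalCStarAlgebra B]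

/-- The linear map `a δ_h ↦ φ(a) u_h` on `C_c(H, A)`. -/
def TwistedAlg.integratedLinear (α : H →* (A ≃⋆ₐ[ℂ] A)) (φ : A →⋆ₙₐ[ℂ] B)
    (u : H →* unitary 𝓜(ℂ, B)) : TwistedAlg α →ₗ[ℂ] B :=
  Finsupp.lsum ℂ fun h => ((u h : 𝓜(ℂ, B)).snd : B →ₗ[ℂ] B) ∘ₗ (φ : A →ₗ[ℂ] B)

lemma TwistedAlg.integratedLinear_single (φ : A →⋆ₙₐ[ℂ] B) (u : H →* unitary 𝓜(ℂ, B))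
    (h : H) (a : A) : integratedLinear α φ u (single α h a) = (u h : 𝓜(ℂ, B)).snd (φ a) :=
  Finsupp.lsum_single _ _ _ _

/-- Each summand `φ(a) u_h` has norm at most `‖a‖`, since `φ` is contractive and `u_h` is unitary.
-/
lemma TwistedAlg.norm_integratedLinear_le (φ : A →⋆ₙₐ[ℂ] B) (u : H →* unitary 𝓜(ℂ, B))
    (f : TwistedAlg α) : ‖integratedLinear α φ u f‖ ≤ l1norm f := by
  refine (norm_sum_le _ _).trans (Finset.sum_le_sum fun h _ => ?_)
  change ‖(u h : 𝓜(ℂ, B)).snd (φ (DFunLike.coe (F := H →₀ A) f h))‖ ≤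
    ‖DFunLike.coe (F := H →₀ A) f h‖
  generalize DFunLike.coe (F := H →₀ A) f h = a
  refine (ContinuousLinearMap.le_opNorm _ _).trans ?_
  rw [DoubleCentralizer.norm_snd]
  have h1 : ‖(u h : 𝓜(ℂ, B))‖ ≤ 1 := by
    -- In the zero algebra a unitary has norm `0` instead of `1`.
    rcases subsingleton_or_nontrivial 𝓜(ℂ, B) with _ | _
    · simp [Subsingleton.elim (u h : 𝓜(ℂ, B)) 0]
    · exact (CStarRing.norm_coe_unitary (u h)).le
  calc ‖(u h : 𝓜(ℂ, B))‖ * ‖φ a‖ ≤ 1 * ‖a‖ := by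
        gcongr
        exact NonUnitalStarAlgHom.norm_apply_le φ _
    _ = ‖a‖ := one_mul _

/-- The integrated form `a δ_h ↦ φ(a) u_h` of a covariant pair `(φ, u)`. -/
def TwistedAlg.integrated (φ : A →⋆ₙₐ[ℂ] B) (u : H →* unitary 𝓜(ℂ, B))
    (hφ : ∀ h a, (φ (α h a) : 𝓜(ℂ, B)) = (u h : 𝓜(ℂ, B)) * φ a * star (u h : 𝓜(ℂ, B))) :
    TwistedAlg α →⋆ₙₐ[ℂ] B where
  toFun := integratedLinear α φ u
  map_smul' := map_smul (integratedLinear α φ u)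
  map_add' := map_add (integratedLinear α φ u)
  map_zero' := map_zero (integratedLinear α φ u)
  map_mul' f k := by
    change integratedLinear α φ u (f * k) = integratedLinear α φ u f * integratedLinear α φ u k
    induction f using induction with
    | h0 => simp
    | hadd f₁ f₂ h₁ h₂ => simp only [add_mul, map_add, h₁, h₂]
    | hs h a =>
      induction k using induction with
      | h0 => simp
      | hadd f₁ f₂ h₁ h₂ => simp only [mul_add, map_add, h₁, h₂]
      | hs k b =>
        rw [single_mul_single]
        simp only [integratedLinear_single]
        -- In `𝓜(ℂ, B)` covariance gives `φ(a) · u_h φ(b) u_h* · u_h u_k = φ(a) u_h · φ(b) u_k`.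
        apply multiplier_coe_injective
        have h1 : ∀ z w : B, ((z * w : B) : 𝓜(ℂ, B)) = (z : 𝓜(ℂ, B)) * (w : 𝓜(ℂ, B)) :=
          fun z w => map_mul DoubleCentralizer.coeHom z w
        have h2 : star (u h : 𝓜(ℂ, B)) * (u h : 𝓜(ℂ, B)) = 1 := Unitary.coe_star_mul_self _
        rw [h1, ← multiplier_coe_mul, ← multiplier_coe_mul, ← multiplier_coe_mul, map_mul, h1,
          hφ, map_mul, Submonoid.coe_mul]
        simp only [mul_assoc]
        rw [← mul_assoc (star (u h : 𝓜(ℂ, B))) (u h : 𝓜(ℂ, B)), h2, one_mul]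
  map_star' f := by
    induction f using induction with
    | h0 => simp
    | hadd f₁ f₂ h₁ h₂ => simp only [star_add, map_add, h₁, h₂]
    | hs h a =>
      rw [star_single]
      simp only [integratedLinear_single]
      -- Covariance at `h⁻¹` gives `u_{h⁻¹} φ(a*) u_{h⁻¹}* · u_{h⁻¹} = u_h* φ(a)* = (φ(a) u_h)*`.
      apply multiplier_coe_injective
      have h1 : ∀ z : B, ((star z : B) : 𝓜(ℂ, B)) = star (z : 𝓜(ℂ, B)) :=
        fun z => map_star DoubleCentralizer.coeHom z
      have h2 : (u h⁻¹ : 𝓜(ℂ, B)) = star (u h : 𝓜(ℂ, B)) := by rw [map_inv]; rfl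
      have h3 : star (u h⁻¹ : 𝓜(ℂ, B)) * (u h⁻¹ : 𝓜(ℂ, B)) = 1 := Unitary.coe_star_mul_self _
      rw [h1, ← multiplier_coe_mul, ← multiplier_coe_mul, hφ, star_mul, map_star, h1, ← h2,
        mul_assoc, h3, mul_one]

lemma TwistedAlg.integrated_single (φ : A →⋆ₙₐ[ℂ] B) (u : H →* unitary 𝓜(ℂ, B))
    (hφ : ∀ h a, (φ (α h a) : 𝓜(ℂ, B)) = (u h : 𝓜(ℂ, B)) * φ a * star (u h : 𝓜(ℂ, B)))
    (h : H) (a : A) : integrated φ u hφ (single α h a) = (u h : 𝓜(ℂ, B)).snd (φ a) :=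
  integratedLinear_single φ u h a

/-- The pulled-back norm `f ↦ ‖π f‖` is one of the C⋆-seminorms whose supremum is the universal
norm. -/
lemma TwistedAlg.norm_starAlgHom_le (π : TwistedAlg α →⋆ₙₐ[ℂ] B)
    (hπ : ∀ f, ‖π f‖ ≤ l1norm f) (f : TwistedAlg α) : ‖π f‖ ≤ ‖f‖ := by
  let p : Seminorm ℂ (TwistedAlg α) := (normSeminorm ℂ B).comp (π : TwistedAlg α →ₗ[ℂ] B)
  have hp : IsCStarSeminorm p :=
    { mul_le := fun f g => by
        change ‖π (f * g)‖ ≤ ‖π f‖ * ‖π g‖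
        rw [map_mul]
        exact norm_mul_le _ _
      star_mul_self := fun f => by
        change ‖π (star f * f)‖ = ‖π f‖ * ‖π f‖
        rw [map_mul, map_star, CStarRing.norm_star_mul_self]
      le_l1norm := hπ }
  exact le_univNorm hp f

/-- The extension to the crossed product of an `ℓ¹`-bounded ⋆-homomorphism on `C_c(H, A)`. -/
def CrossedProduct.lift (π : TwistedAlg α →⋆ₙₐ[ℂ] B) (hπ : ∀ f, ‖π f‖ ≤ TwistedAlg.l1norm f) :
    CrossedProduct α →⋆ₙₐ[ℂ] B :=
  let π' : TwistedAlg α →L[ℂ] B := (π : TwistedAlg α →ₗ[ℂ] B).mkContinuous 1 fun f => by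
    simpa using TwistedAlg.norm_starAlgHom_le π hπ f
  let Φ : CrossedProduct α → B := UniformSpace.Completion.extension π'
  have hΦ : Continuous Φ := UniformSpace.Completion.continuous_extension
  have hof : ∀ f, Φ (of f) = π f := UniformSpace.Completion.extension_coe π'.uniformContinuous
  { toFun := Φ
    map_smul' := fun c x => denseRange_of.induction_on (p := fun x => Φ (c • x) = c • Φ x) x
      (isClosed_eq (hΦ.comp (continuous_const_smul c)) (hΦ.const_smul c))
      (fun f => by rw [← of_smul, hof, hof, map_smul])
    map_zero' := by rw [← of_zero, hof, map_zero]
    map_add' := fun x y => denseRange_of.induction_on₂ (p := fun x y => Φ (x + y) = Φ x + Φ y)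
      (isClosed_eq (by fun_prop) (by fun_prop))
      (fun f g => by rw [← of_add, hof, hof, hof, map_add]) x y
    map_mul' := fun x y => denseRange_of.induction_on₂ (p := fun x y => Φ (x * y) = Φ x * Φ y)
      (isClosed_eq (by fun_prop) (by fun_prop))
      (fun f g => by rw [← of_mul, hof, hof, hof, map_mul]) x y
    map_star' := fun x => denseRange_of.induction_on (p := fun x => Φ (star x) = star (Φ x)) x
      (isClosed_eq (hΦ.comp continuous_star') hΦ.star)
      (fun f => by rw [← of_star, hof, hof, map_star]) }

lemma CrossedProduct.lift_of (π : TwistedAlg α →⋆ₙₐ[ℂ] B)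
    (hπ : ∀ f, ‖π f‖ ≤ TwistedAlg.l1norm f) (f : TwistedAlg α) : lift π hπ (of f) = π f :=
  UniformSpace.Completion.extension_coe
    ((π : TwistedAlg α →ₗ[ℂ] B).mkContinuous 1 fun f => by
      simpa using TwistedAlg.norm_starAlgHom_le π hπ f).uniformContinuous f

/-- Sums of elements `a δ_g` are dense. Bare additive continuous functions are allowed so that both
sides of an equivariance identity can be compared directly. -/
lemma CrossedProduct.hom_ext_of_single {f₁ f₂ : CrossedProduct α → B} (h₁ : Continuous f₁)
    (h₂ : Continuous f₂) (hadd₁ : ∀ x y, f₁ (x + y) = f₁ x + f₁ y)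
    (hadd₂ : ∀ x y, f₂ (x + y) = f₂ x + f₂ y)
    (h : ∀ g a, f₁ (of (TwistedAlg.single α g a)) = f₂ (of (TwistedAlg.single α g a))) :
    f₁ = f₂ :=
  funext fun x => denseRange_of.induction_on (p := fun x => f₁ x = f₂ x) x (isClosed_eq h₁ h₂)
    fun f => by
      induction f using TwistedAlg.induction with
      | h0 => simpa only [TwistedAlg.single_zero] using h 1 0
      | hadd f g hf hg => rw [of_add, hadd₁, hadd₂, hf, hg]
      | hs g a => exact h g a

end UniversalProperty

/-! ### A representation by multipliers yields a splitting -/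

section Splitting

variable {A : Type u} [NonUnitalCStarAlgebra A] {H : Type v} [Group H]
  [TopologicalSpace H] [DiscreteTopology H] {α : H →* (A ≃⋆ₐ[ℂ] A)}

theorem isEquivariantlySequentiallySplit_of_unitary (w : H →* unitary 𝓜(ℂ, DAlg A))
    (h1 : ∀ (h : H) (a : A), (DAlg.const (α h a) : 𝓜(ℂ, DAlg A)) =
      (w h : 𝓜(ℂ, DAlg A)) * DAlg.const a * star (w h : 𝓜(ℂ, DAlg A)))
    (h2 : ∀ g h : H, multAction α h (w g) = w (h * g * h⁻¹)) :
    IsEquivariantlySequentiallySplit (crossedInclusion α) := by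
  let Ψ : CrossedProduct α →⋆ₙₐ[ℂ] DAlg A :=
    CrossedProduct.lift (TwistedAlg.integrated DAlg.const w h1)
      (TwistedAlg.norm_integratedLinear_le DAlg.const w)
  have hΨ : ∀ h a, Ψ (CrossedProduct.of (TwistedAlg.single α h a)) =
      (w h : 𝓜(ℂ, DAlg A)).snd (DAlg.const a) := fun h a => by
    exact (CrossedProduct.lift_of _ _ _).trans (TwistedAlg.integrated_single DAlg.const w h1 h a)
  let ψ : CrossedProduct α →⋆ₙₐ[ℂ] SeqAlg A :=
    (NonUnitalStarSubalgebraClass.subtype (DAlg A)).comp Ψ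
  have hψ : Continuous ψ := AddMonoidHomClass.continuous_of_bound ψ 1 fun x => by
    simpa using NonUnitalStarAlgHom.norm_apply_le ψ x
  refine ⟨⟨ψ, fun g x => ?_⟩, fun x => continuous_of_discreteTopology, fun a => ?_⟩
  · refine congrFun (CrossedProduct.hom_ext_of_single
      (f₁ := fun x => ψ (ad (CrossedProduct.lambda α g) x)) (f₂ := fun x => seqAction α g (ψ x))
      (hψ.comp (StarAlgEquiv.isometry _).continuous)
      ((StarAlgEquiv.isometry (seqAction α g)).continuous.comp hψ)
      (fun x y => by simp only [map_add]) (fun x y => by simp only [map_add]) fun h a => ?_) x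
    rw [CrossedProduct.ad_lambda_of_single]
    change (Ψ _ : SeqAlg A) = seqAction α g (Ψ _ : SeqAlg A)
    -- By the conjugation rule `w_{ghg⁻¹}` is the image of `w_h` under the extended automorphism.
    -- Its right action is `σ R σ⁻¹`, and `σ⁻¹` turns `α_g(a)` back into `a`.
    rw [hΨ, hΨ, ← h2]
    change seqAction α g ((w h : 𝓜(ℂ, DAlg A)).snd
      ((DAlg.aut (α g))⁻¹ (DAlg.const (α g a))) : SeqAlg A) = _
    have h3 : (DAlg.aut (α g))⁻¹ (DAlg.const (α g a)) = DAlg.const a :=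
      (DAlg.aut (α g)).symm_apply_apply (DAlg.const a)
    rw [h3]
  · change (Ψ (CrossedProduct.of (TwistedAlg.single α 1 a)) : SeqAlg A) = SeqAlg.const a
    rw [hΨ, map_one]
    rfl

end Splitting

/-! ### A splitting yields approximate representability -/

/-! ### Approximate units of contractions and their stability under products, adjoints and
automorphisms. -/

section ContractiveUnits

variable {A : Type u} [NonUnitalCStarAlgebra A] {l : Filter A}

/-- The family `(f e)_e` consists of contractions and is an approximate unit along `l`. -/
structure IsContractiveUnit (l : Filter A) (f : A → A) : Prop where
  norm_le : ∀ᶠ e in l, ‖f e‖ ≤ 1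
  mul_right : ∀ a, Tendsto (fun e => f e * a) l (𝓝 a)
  mul_left : ∀ a, Tendsto (fun e => a * f e) l (𝓝 a)

namespace IsContractiveUnit

variable {f k : A → A}

protected lemma star (hf : IsContractiveUnit l f) : IsContractiveUnit l fun e => star (f e) where
  norm_le := by simpa only [norm_star] using hf.norm_le
  mul_right a := by simpa using (hf.mul_left (star a)).star
  mul_left a := by simpa using (hf.mul_right (star a)).star

protected lemma map (hf : IsContractiveUnit l f) (σ : A ≃⋆ₐ[ℂ] A) :
    IsContractiveUnit l fun e => σ (f e) where
  norm_le := hf.norm_le.mono fun _ he => (NonUnitalStarAlgHom.norm_apply_le σ _).trans he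
  mul_right a := by
    have := ((StarAlgEquiv.isometry σ).continuous.tendsto _).comp (hf.mul_right (σ.symm a))
    simpa [Function.comp_def] using this
  mul_left a := by
    have := ((StarAlgEquiv.isometry σ).continuous.tendsto _).comp (hf.mul_left (σ.symm a))
    simpa [Function.comp_def] using this

lemma tendsto_mul_mul (hf : IsContractiveUnit l f) (hk : IsContractiveUnit l k) (a : A) :
    Tendsto (fun e => f e * a * k e) l (𝓝 a) := by
  rw [tendsto_iff_norm_sub_tendsto_zero]
  have h1 := (tendsto_iff_norm_sub_tendsto_zero.1 (hf.mul_right a)).add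
    (tendsto_iff_norm_sub_tendsto_zero.1 (hk.mul_left a))
  rw [add_zero] at h1
  refine squeeze_zero' (Eventually.of_forall fun _ => norm_nonneg _) ?_ h1
  filter_upwards [hk.norm_le] with e he
  have h2 : f e * a * k e - a = (f e * a - a) * k e + (a * k e - a) := by
    rw [sub_mul]; abel
  rw [h2]
  refine (norm_add_le _ _).trans (add_le_add_left ?_ _)
  exact (norm_mul_le _ _).trans (mul_le_of_le_one_right (norm_nonneg _) he)

protected lemma mul (hf : IsContractiveUnit l f) (hk : IsContractiveUnit l k) :
    IsContractiveUnit l fun e => f e * k e where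
  norm_le := by
    filter_upwards [hf.norm_le, hk.norm_le] with e h1 h2
    exact (norm_mul_le _ _).trans (mul_le_one₀ h1 (norm_nonneg _) h2)
  mul_right a := by
    rw [tendsto_iff_norm_sub_tendsto_zero]
    have h1 := (tendsto_iff_norm_sub_tendsto_zero.1 (hk.mul_right a)).add
      (tendsto_iff_norm_sub_tendsto_zero.1 (hf.mul_right a))
    rw [add_zero] at h1
    refine squeeze_zero' (Eventually.of_forall fun _ => norm_nonneg _) ?_ h1
    filter_upwards [hf.norm_le] with e he
    have h2 : f e * k e * a - a = f e * (k e * a - a) + (f e * a - a) := by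
      rw [mul_sub, mul_assoc]; abel
    rw [h2]
    refine (norm_add_le _ _).trans (add_le_add_left ?_ _)
    exact (norm_mul_le _ _).trans (mul_le_of_le_one_left (norm_nonneg _) he)
  mul_left a := by
    rw [tendsto_iff_norm_sub_tendsto_zero]
    have h1 := (tendsto_iff_norm_sub_tendsto_zero.1 (hf.mul_left a)).add
      (tendsto_iff_norm_sub_tendsto_zero.1 (hk.mul_left a))
    rw [add_zero] at h1
    refine squeeze_zero' (Eventually.of_forall fun _ => norm_nonneg _) ?_ h1
    filter_upwards [hk.norm_le] with e he
    have h2 : a * (f e * k e) - a = (a * f e - a) * k e + (a * k e - a) := by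
      rw [sub_mul, mul_assoc]; abel
    rw [h2]
    refine (norm_add_le _ _).trans (add_le_add_left ?_ _)
    exact (norm_mul_le _ _).trans (mul_le_of_le_one_right (norm_nonneg _) he)

lemma sub_tendsto_mul_right (hf : IsContractiveUnit l f) (hk : IsContractiveUnit l k) (a : A) :
    Tendsto (fun e => (f e - k e) * a) l (𝓝 0) := by
  simpa only [sub_mul, sub_self] using (hf.mul_right a).sub (hk.mul_right a)

lemma sub_tendsto_mul_left (hf : IsContractiveUnit l f) (hk : IsContractiveUnit l k) (a : A) :
    Tendsto (fun e => a * (f e - k e)) l (𝓝 0) := by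
  simpa only [mul_sub, sub_self] using (hf.mul_left a).sub (hk.mul_left a)

lemma mul_right_sub_tendsto (hf : IsContractiveUnit l f) (a : A) :
    Tendsto (fun e => f e * a - a) l (𝓝 0) := by
  simpa only [sub_self] using (hf.mul_right a).sub_const a

lemma mul_left_sub_tendsto (hf : IsContractiveUnit l f) (a : A) :
    Tendsto (fun e => a * f e - a) l (𝓝 0) := by
  simpa only [sub_self] using (hf.mul_left a).sub_const a

end IsContractiveUnit

variable (A) in
/-- Every C⋆-algebra has an approximate unit consisting of strict contractions. -/
lemma exists_isContractiveUnit_norm_lt_one :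
    ∃ l : Filter A, l.NeBot ∧ (∀ᶠ e in l, ‖e‖ < 1) ∧ IsContractiveUnit l id := by
  let := CStarAlgebra.spectralOrder A
  let := CStarAlgebra.spectralOrderedRing A
  have hl := CStarAlgebra.increasingApproximateUnit A
  have := hl.neBot
  -- Scaling an approximate unit of contractions by `t < 1` with `t → 1` makes the contractions
  -- strict. Strictness leaves room to lift an element of `A_∞` to a sequence of norm at most `1`.
  let L : Filter (ℝ × A) := 𝓝[<] 1 ×ˢ CStarAlgebra.approximateUnit A
  have h1 : Tendsto (fun p : ℝ × A => (p.1 : ℂ)) L (𝓝 1) := by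
    have h : Tendsto (fun t : ℝ => (t : ℂ)) (𝓝 1) (𝓝 1) := by
      simpa using Complex.continuous_ofReal.tendsto 1
    exact (h.mono_left nhdsWithin_le_nhds).comp tendsto_fst
  have hlt : ∀ᶠ p in L, ‖(p.1 : ℂ) • p.2‖ < 1 := by
    have h2 : ∀ᶠ t : ℝ in 𝓝[<] 1, 0 ≤ t ∧ t < 1 := by
      filter_upwards [Ioo_mem_nhdsLT (show (0 : ℝ) < 1 by norm_num)] with t ht
      exact ⟨ht.1.le, ht.2⟩
    filter_upwards [h2.prod_mk hl.eventually_norm] with p hp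
    rw [norm_smul, Complex.norm_of_nonneg hp.1.1]
    exact (mul_le_of_le_one_right hp.1.1 hp.2).trans_lt hp.1.2
  refine ⟨map (fun p : ℝ × A => (p.1 : ℂ) • p.2) L, inferInstance, hlt, ?_, fun a => ?_,
    fun a => ?_⟩
  · exact hlt.mono fun _ h => h.le
  · have := h1.smul ((hl.tendsto_mul_right a).comp (tendsto_snd (f := 𝓝[<] (1 : ℝ))))
    rw [one_smul] at this
    exact tendsto_map'_iff.2 (this.congr fun p => (smul_mul_assoc _ _ _).symm)
  · have := h1.smul ((hl.tendsto_mul_left a).comp (tendsto_snd (f := 𝓝[<] (1 : ℝ))))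
    rw [one_smul] at this
    exact tendsto_map'_iff.2 (this.congr fun p => (mul_smul_comm _ _ _).symm)

end ContractiveUnits

/-! ### Defects of the relations, their vanishing in `A_∞`, and the passage back to `A`. -/

section Defects

variable {A : Type u} [NonUnitalCStarAlgebra A] {H : Type v} [Group H]
  {α : H →* (A ≃⋆ₐ[ℂ] A)}

/-- The elements that vanish exactly when the family `z` represents the action, where `j` embeds
`A` into `B`, and `β` is the action on `B`. -/
def defect {B : Type*} [Mul B] [Sub B] [Star B] (α : H →* (A ≃⋆ₐ[ℂ] A)) (j : A → B)
    (β : H → B → B) (z : H → B) (g h : H) (a : A) : Fin 9 → B :=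
  ![z h * star (z h) * j a - j a,
    j a * (z h * star (z h)) - j a,
    star (z h) * z h * j a - j a,
    j a * (star (z h) * z h) - j a,
    j a * (z g * z h - z (g * h)),
    (z g * z h - z (g * h)) * j a,
    j (α h a) - z h * j a * star (z h),
    j a * (z (g * h * g⁻¹) - β g (z h)),
    (z (g * h * g⁻¹) - β g (z h)) * j a]

/-- A defect uses only products, differences, adjoints and the action. The quotient map and
evaluation at a coordinate both respect these, so the same expression formed in `ℓ^∞` serves both
purposes. -/
lemma exists_mk_eq_defect (α : H →* (A ≃⋆ₐ[ℂ] A)) (y : H → BddSeq A) (g h : H) (a : A)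
    (i : Fin 9) : ∃ x : BddSeq A,
      SeqAlg.mk x = defect α SeqAlg.const (fun g => seqAction α g) (fun h => SeqAlg.mk (y h))
        g h a i ∧
      ∀ m, x m = defect α id (fun g => α g) (fun h => y h m) g h a i := by
  let c : A → BddSeq A := fun a => ⟨fun _ => a, memℓp_infty ⟨‖a‖, by rintro _ ⟨n, rfl⟩; rfl⟩⟩
  refine ⟨defect α c (fun g => SeqAlg.mapBdd (α g)) y g h a i, ?_, fun m => ?_⟩
  · fin_cases i <;> rfl
  · fin_cases i <;> rfl

lemma defect_sub (z : H → A) (g h : H) (a b : A) (i : Fin 9) :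
    defect α id (fun g => α g) z g h (a - b) i =
      defect α id (fun g => α g) z g h a i - defect α id (fun g => α g) z g h b i := by
  fin_cases i <;> simp [defect, mul_sub, sub_mul] <;> abel

/-- Every entry is a difference of two terms of norm at most `‖a‖`. With `defect_sub` this makes
defects `2`-Lipschitz in `a`, uniformly over contractive families, so a dense set of `a` suffices
for testing. -/
lemma norm_defect_le {z : H → A} (hz : ∀ h, ‖z h‖ ≤ 1) (g h : H) (a : A) (i : Fin 9) :
    ‖defect α id (fun g => α g) z g h a i‖ ≤ 2 * ‖a‖ := by
  have hs : ∀ h, ‖star (z h)‖ ≤ 1 := fun h => by rw [norm_star]; exact hz h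
  have hα : ∀ g (b : A), ‖α g b‖ ≤ ‖b‖ := fun g b => NonUnitalStarAlgHom.norm_apply_le (α g) b
  have hm : ∀ {x y : A}, ‖x‖ ≤ 1 → ‖y‖ ≤ 1 → ‖x * y‖ ≤ 1 := fun hx hy =>
    (norm_mul_le _ _).trans (mul_le_one₀ hx (norm_nonneg _) hy)
  have hl : ∀ {x : A} (b : A), ‖x‖ ≤ 1 → ‖x * b‖ ≤ ‖b‖ := fun b hx =>
    (norm_mul_le _ _).trans (mul_le_of_le_one_left (norm_nonneg _) hx)
  have hr : ∀ {x : A} (b : A), ‖x‖ ≤ 1 → ‖b * x‖ ≤ ‖b‖ := fun b hx =>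
    (norm_mul_le _ _).trans (mul_le_of_le_one_right (norm_nonneg _) hx)
  have hsub : ∀ {x y : A}, ‖x‖ ≤ ‖a‖ → ‖y‖ ≤ ‖a‖ → ‖x - y‖ ≤ 2 * ‖a‖ := fun hx hy =>
    (norm_sub_le _ _).trans (by rw [two_mul]; exact add_le_add hx hy)
  fin_cases i
  · exact hsub (hl _ (hm (hz h) (hs h))) le_rfl
  · exact hsub (hr _ (hm (hz h) (hs h))) le_rfl
  · exact hsub (hl _ (hm (hs h) (hz h))) le_rfl
  · exact hsub (hr _ (hm (hs h) (hz h))) le_rfl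
  · change ‖a * (z g * z h - z (g * h))‖ ≤ _
    rw [mul_sub]
    exact hsub (hr _ (hm (hz g) (hz h))) (hr _ (hz _))
  · change ‖(z g * z h - z (g * h)) * a‖ ≤ _
    rw [sub_mul]
    exact hsub (hl _ (hm (hz g) (hz h))) (hl _ (hz _))
  · exact hsub (hα h a) ((hr _ (hs h)).trans (hl _ (hz h)))
  · change ‖a * (z (g * h * g⁻¹) - α g (z h))‖ ≤ _
    rw [mul_sub]
    exact hsub (hr _ (hz _)) (hr _ ((hα _ _).trans (hz h)))
  · change ‖(z (g * h * g⁻¹) - α g (z h)) * a‖ ≤ _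
    rw [sub_mul]
    exact hsub (hl _ (hz _)) (hl _ ((hα _ _).trans (hz h)))

lemma IsApproximatelyRepresentable.of_defect {x : ℕ → H → A} (hx : ∀ n h, ‖x n h‖ ≤ 1)
    (h : ∀ g h a i, Tendsto (fun n => defect α id (fun g => α g) (x n) g h a i) atTop (𝓝 0)) :
    IsApproximatelyRepresentable α := by
  have key : ∀ {f : ℕ → A} {a : A}, Tendsto (fun n => f n - a) atTop (𝓝 0) →
      Tendsto f atTop (𝓝 a) := fun hf => tendsto_sub_nhds_zero_iff.1 hf
  refine ⟨x, hx, fun k => ⟨⟨fun a => ?_, fun a => ?_⟩, ⟨fun a => ?_, fun a => ?_⟩⟩,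
    fun g k a => ?_, fun a k => ?_, fun g k a => ?_⟩
  · exact tendsto_map'_iff.2 (key (h 1 k a 1))
  · exact tendsto_map'_iff.2 (key (h 1 k a 0))
  · exact tendsto_map'_iff.2 (key (h 1 k a 3))
  · exact tendsto_map'_iff.2 (key (h 1 k a 2))
  · simpa using! (h g k a 4).norm.add (h g k a 5).norm
  · simpa using! (h 1 k a 6).norm
  · simpa using! (h g k a 7).norm.add (h g k a 8).norm

/-- Diagonal argument: the triples `(g, h, d)` with `d` in a countable dense set are enumerated, and
the `n`-th family is good on the first `n + 1` of them with tolerance `1 / (n + 1)`. -/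
lemma IsApproximatelyRepresentable.of_forall_finset [TopologicalSpace.SeparableSpace A]
    [Countable H]
    (h : ∀ (S : Finset (H × H × A)) (ε : ℝ), 0 < ε → ∃ z : H → A, (∀ h, ‖z h‖ ≤ 1) ∧
      ∀ t ∈ S, ∀ i, ‖defect α id (fun g => α g) z t.1 t.2.1 t.2.2 i‖ ≤ ε) :
    IsApproximatelyRepresentable α := by
  classical
  obtain ⟨s, hs⟩ := exists_surjective_nat (H × H × ℕ)
  let d : ℕ → A := TopologicalSpace.denseSeq A
  let t : ℕ → H × H × A := fun k => ((s k).1, (s k).2.1, d (s k).2.2)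
  choose x hx hxd using fun n : ℕ =>
    h ((Finset.range (n + 1)).image t) (1 / ((n : ℝ) + 1)) Nat.one_div_pos_of_nat
  refine .of_defect hx fun g k a i => ?_
  rw [Metric.tendsto_atTop]
  intro ε hε
  -- Replacing `a` by a point within `ε / 4` costs less than `ε / 2` by the Lipschitz bound; the
  -- tolerance `1 / (n + 1) < ε / 2` accounts for the rest.
  obtain ⟨q, hq⟩ := (TopologicalSpace.denseRange_denseSeq A).exists_dist_lt a
    (show 0 < ε / 4 by positivity)
  obtain ⟨p, hp⟩ := hs (g, k, q)
  obtain ⟨N, hN⟩ := exists_nat_one_div_lt (show 0 < ε / 2 by positivity)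
  refine ⟨max p N, fun n hn => ?_⟩
  have h1 := hxd n (t p) (Finset.mem_image_of_mem t (Finset.mem_range.2 (by omega))) i
  have h2 : t p = (g, k, d q) := by simp only [t, hp]
  rw [h2] at h1
  have h3 := norm_defect_le (α := α) (hx n) g k (a - d q) i
  rw [defect_sub] at h3
  rw [dist_eq_norm] at hq
  rw [dist_zero_right]
  have h4 : 1 / ((n : ℝ) + 1) ≤ 1 / ((N : ℝ) + 1) :=
    Nat.one_div_le_one_div ((le_max_right p N).trans hn)
  have h5 := norm_le_norm_add_norm_sub' (defect α id (fun g => α g) (x n) g k a i)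
    (defect α id (fun g => α g) (x n) g k (d q) i)
  change ‖a - d q‖ < ε / 4 at hq
  linarith

/-- In the crossed product the relations for `e δ_h` become statements about coefficients: `(e
δ_g)(e δ_h) = e α_g(e) δ_{gh}`, while `(e δ_h)(e δ_h)*` and `(e δ_h)*(e δ_h)` have coefficients `e
e*` and `α_{h⁻¹}(e* e)` at the identity, and `ad(λ_g)` sends `e δ_h` to `α_g(e) δ_{ghg⁻¹}`. All
these coefficients are again contractive approximate units, and `b ↦ ψ(b δ_k)` is contractive, so
each defect is controlled by a limit in `A`. -/
lemma tendsto_defect {l : Filter A} (hl : IsContractiveUnit l id)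
    {ψ : CrossedProduct α →⋆ₙₐ[ℂ] SeqAlg A}
    (hψ : ∀ g x, ψ (ad (CrossedProduct.lambda α g) x) = seqAction α g (ψ x))
    (hι : ∀ a, ψ (CrossedProduct.incl α a) = SeqAlg.const a) (g h : H) (a : A) (i : Fin 9) :
    Tendsto (fun e => defect α SeqAlg.const (fun g => seqAction α g)
      (fun h => ψ (CrossedProduct.of (TwistedAlg.single α h e))) g h a i) l (𝓝 0) := by
  let P : H → A → SeqAlg A := fun h b => ψ (CrossedProduct.of (TwistedAlg.single α h b))
  have hP : ∀ h b, P h b = ψ (CrossedProduct.of (TwistedAlg.single α h b)) := fun _ _ => rfl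
  simp only [← hP]
  have hmul : ∀ g h b c, P g b * P h c = P (g * h) (b * α g c) := fun g h b c => by
    simp only [hP]
    rw [← map_mul, ← CrossedProduct.of_mul, TwistedAlg.single_mul_single]
  have hstar : ∀ h b, star (P h b) = P h⁻¹ (α h⁻¹ (star b)) := fun h b => by
    simp only [hP]
    rw [← map_star, ← CrossedProduct.of_star, TwistedAlg.star_single]
  have hsub : ∀ h b c, P h (b - c) = P h b - P h c := fun h b c => by
    rw [eq_sub_iff_add_eq]
    simp only [hP]
    rw [← map_add, ← CrossedProduct.of_add, ← TwistedAlg.single_add, sub_add_cancel]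
  have hone : ∀ b, SeqAlg.const b = P 1 b := fun b => (hι b).symm
  have hact : ∀ g h b, seqAction α g (P h b) = P (g * h * g⁻¹) (α g b) := fun g h b => by
    simp only [hP]
    rw [← hψ, ← CrossedProduct.ad_lambda_of_single]
  have hnorm : ∀ h b, ‖P h b‖ ≤ ‖b‖ := fun h b =>
    (NonUnitalStarAlgHom.norm_apply_le ψ _).trans (CrossedProduct.norm_of_single_le h b)
  have hlim : ∀ (k : H) {f : A → A}, Tendsto f l (𝓝 0) →
      Tendsto (fun e => P k (f e)) l (𝓝 0) := fun k f hf =>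
    squeeze_zero_norm (fun e => hnorm k (f e)) (by simpa using hf.norm)
  have hα1 : ∀ b, α 1 b = b := fun b => by rw [map_one, StarAlgEquiv.one_apply]
  have hzz : ∀ h e, P h e * star (P h e) = P 1 (e * star e) := fun h e => by
    rw [hstar, hmul, mul_inv_cancel, TwistedAlg.apply_apply_inv]
  have hzz' : ∀ h e, star (P h e) * P h e = P 1 (α h⁻¹ (star e * e)) := fun h e => by
    rw [hstar, hmul, inv_mul_cancel, map_mul]
  have hs := hl.star
  fin_cases i
  · refine (hlim 1 ((hl.mul hs).mul_right_sub_tendsto a)).congr fun e => ?_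
    change _ = P h e * star (P h e) * SeqAlg.const a - SeqAlg.const a
    rw [hzz, hone, hmul, hα1, mul_one, hsub]
    rfl
  · refine (hlim 1 ((hl.mul hs).mul_left_sub_tendsto a)).congr fun e => ?_
    change _ = SeqAlg.const a * (P h e * star (P h e)) - SeqAlg.const a
    rw [hzz, hone, hmul, hα1, mul_one, hsub]
    rfl
  · refine (hlim 1 (((hs.mul hl).map (α h⁻¹)).mul_right_sub_tendsto a)).congr fun e => ?_
    change _ = star (P h e) * P h e * SeqAlg.const a - SeqAlg.const a
    rw [hzz', hone, hmul, hα1, mul_one, hsub]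
    rfl
  · refine (hlim 1 (((hs.mul hl).map (α h⁻¹)).mul_left_sub_tendsto a)).congr fun e => ?_
    change _ = SeqAlg.const a * (star (P h e) * P h e) - SeqAlg.const a
    rw [hzz', hone, hmul, hα1, mul_one, hsub]
    rfl
  · refine (hlim (g * h) ((hl.mul (hl.map (α g))).sub_tendsto_mul_left hl a)).congr fun e => ?_
    change _ = SeqAlg.const a * (P g e * P h e - P (g * h) e)
    rw [hmul, ← hsub, hone, hmul, hα1, one_mul]
    rfl
  -- Multiplying `b δ_k` on the right by `a` gives `b α_k(a) δ_k`, so the approximate unit is tested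
  -- against `α_k(a)`.
  · refine (hlim (g * h) ((hl.mul (hl.map (α g))).sub_tendsto_mul_right hl
      (α (g * h) a))).congr fun e => ?_
    change _ = (P g e * P h e - P (g * h) e) * SeqAlg.const a
    rw [hmul, ← hsub, hone, hmul, mul_one]
    rfl
  · have h1 : Tendsto (fun e => α h a - e * α h a * star e) l (𝓝 0) := by
      simpa using (hl.tendsto_mul_mul hs (α h a)).const_sub (α h a)
    refine (hlim 1 h1).congr fun e => ?_
    change _ = SeqAlg.const (α h a) - P h e * SeqAlg.const a * star (P h e)
    rw [hone, hone, hstar, hmul, hmul, mul_one, mul_inv_cancel, TwistedAlg.apply_apply_inv, hsub]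
  · refine (hlim (g * h * g⁻¹) (hl.sub_tendsto_mul_left (hl.map (α g)) a)).congr fun e => ?_
    change _ = SeqAlg.const a * (P (g * h * g⁻¹) e - seqAction α g (P h e))
    rw [hact, ← hsub, hone, hmul, hα1, one_mul]
    rfl
  · refine (hlim (g * h * g⁻¹) (hl.sub_tendsto_mul_right (hl.map (α g))
      (α (g * h * g⁻¹) a))).congr fun e => ?_
    change _ = (P (g * h * g⁻¹) e - seqAction α g (P h e)) * SeqAlg.const a
    rw [hact, ← hsub, hone, hmul, mul_one]
    rfl

/-- One `e` makes finitely many defects of `ψ(e δ_h)` smaller than `ε` in `A_∞`. A quotient norm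
below `ε` bounds all but finitely many coordinates of any representative by `ε`, so some single
coordinate serves all these relations at once. -/
theorem isApproximatelyRepresentable_of_split [TopologicalSpace.SeparableSpace A] [Countable H]
    [TopologicalSpace H]
    (hα : IsEquivariantlySequentiallySplit (crossedInclusion α)) :
    IsApproximatelyRepresentable α := by
  obtain ⟨⟨ψ, hψ⟩, -, hι⟩ := hα
  obtain ⟨l, hne, hlt, hl⟩ := exists_isContractiveUnit_norm_lt_one A
  refine .of_forall_finset fun S ε hε => ?_
  have h1 : ∀ᶠ e in l, ∀ t ∈ S, ∀ i, ‖defect α SeqAlg.const (fun g => seqAction α g)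
      (fun h => ψ (CrossedProduct.of (TwistedAlg.single α h e))) t.1 t.2.1 t.2.2 i‖ < ε := by
    rw [Finset.eventually_all]
    intro t _
    rw [eventually_all]
    intro i
    have := (tendsto_defect hl hψ hι t.1 t.2.1 t.2.2 i).norm
    rw [norm_zero] at this
    exact this.eventually (gt_mem_nhds hε)
  obtain ⟨e, he, hed⟩ := (hlt.and h1).exists
  have h2 : ∀ h, ∃ y : BddSeq A,
      SeqAlg.mk y = ψ (CrossedProduct.of (TwistedAlg.single α h e)) ∧ ‖y‖ ≤ 1 := fun h => by
    have h3 : ‖ψ (CrossedProduct.of (TwistedAlg.single α h e))‖ < 1 :=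
      ((NonUnitalStarAlgHom.norm_apply_le ψ _).trans
        (CrossedProduct.norm_of_single_le h e)).trans_lt he
    -- The margin `1 - ‖ψ(e δ_h)‖` is positive because `e` is a strict contraction; it yields a
    -- representative all of whose coordinates are contractions, for every `h` and not only those
    -- tested.
    obtain ⟨y, hy, hy1⟩ := SeqAlg.exists_mk_lt
      (ψ (CrossedProduct.of (TwistedAlg.single α h e))) (sub_pos.2 h3)
    exact ⟨y, hy, by linarith⟩
  choose y hy hy1 using h2
  simp only [← hy] at hed
  have h3 : ∀ᶠ m in atTop, ∀ t ∈ S, ∀ i,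
      ‖defect α id (fun g => α g) (fun h => y h m) t.1 t.2.1 t.2.2 i‖ ≤ ε := by
    rw [Finset.eventually_all]
    intro t ht
    rw [eventually_all]
    intro i
    obtain ⟨x, hx, hxm⟩ := exists_mk_eq_defect α y t.1 t.2.1 t.2.2 i
    have h4 := hed t ht i
    rw [← hx] at h4
    filter_upwards [SeqAlg.eventually_norm_le x h4] with m hm
    rw [← hxm]
    exact hm
  obtain ⟨m, hm⟩ := h3.exists
  exact ⟨fun h => y h m, fun h => (lp.norm_apply_le_norm (by simp) (y h) m).trans (hy1 h), hm⟩

end Defects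

end CStarDyn

end

theorem proposition4p21 {A : Type*} [NonUnitalCStarAlgebra A] [TopologicalSpace.SeparableSpace A]
    {H : Type*} [Group H] [Countable H] [TopologicalSpace H] [DiscreteTopology H]
    (α : H →* (A ≃⋆ₐ[ℂ] A)) :
    List.TFAE [
      CStarDyn.IsApproximatelyRepresentable α,
      ∃ w : H →* unitary (DoubleCentralizer ℂ (CStarDyn.DAlg A)),
        (∀ (h : H) (a : A),
          (CStarDyn.DAlg.const (α h a) : DoubleCentralizer ℂ (CStarDyn.DAlg A)) =
            (w h : DoubleCentralizer ℂ (CStarDyn.DAlg A)) * CStarDyn.DAlg.const a *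
              star (w h : DoubleCentralizer ℂ (CStarDyn.DAlg A))) ∧
        ∀ g h : H, CStarDyn.multAction α h (w g) = w (h * g * h⁻¹),
      CStarDyn.IsEquivariantlySequentiallySplit (CStarDyn.crossedInclusion α)] := by
  tfae_have 1 → 2 := fun h => h.exists_unitary
  tfae_have 2 → 3 := fun ⟨w, h1, h2⟩ =>
    CStarDyn.isEquivariantlySequentiallySplit_of_unitary w h1 h2
  tfae_have 3 → 1 := CStarDyn.isApproximatelyRepresentable_of_split
  tfae_finish
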